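/- Let $Y=\mathbb Z^d\subset\mathfrak t_{\mathbb R}=\mathbb R^d\subset\mathfrak t=\mathbb C^d$, let $\xi_1,\dots,\xi_n\in\operatorname{Hom}(Y,\mathbb Z)$ (weights, also viewed as linear functions on $\mathfrak t$), $b_1,\dots,b_n\in\mathbb C$ (flavors) and $\zeta\in\operatorname{Hom}(Y,\mathbb C)$. Let $\mathcal A$ be the quantized abelian Coulomb branch with these parameters: the free left $\mathbb C[\mathfrak t]$-module on symbols $r^\lambda$, $\lambda\in Y$, with the product $$(f r^\lambda)(h r^\mu)=f\,S_\lambda(h)\prod_{i=1}^n A_i(\lambda,\mu)\,r^{\lambda+\mu},\qquad (S_\lambda h)(z)=h(z+\lambda),$$ where, for $p=\xi_i(\lambda)$, $q=\xi_i(\mu)$, $m=\min(|p|,|q|)$, one has $A_i(\lambda,\mu)=\prod_{j=1}^{m}(\xi_i+b_i+p-j+\tfrac12)$ if $p>0>q$, $A_i(\lambda,\mu)=\prod_{j=1}^{m}(\xi_i+b_i+p+j-\tfrac12)$ if $p<0<q$, and $A_i(\lambda,\mu)=1$ otherwise. Let $g$ be the automorphism $g(fr^\lambda)=e^{2\pi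 i\zeta(\lambda)}fr^\lambda$ and let $T\colon\mathcal A\to\mathbb C$ be a $g$-twisted trace, i.e. a linear map with $T(ab)=T(b\,g(a))$ for all $a,b\in\mathcal A$. (1) The restriction of $T$ to $\mathbb C[\mathfrak t]=\mathbb C[\mathfrak t]r^0$ can be written as a finite sum $$T(R)=\sum_{(U,D,\eta,w)}\int_{U+i\eta}(DR)(ix)\,w(x-i\eta)\,dx ,\qquad R\in\mathbb C[\mathfrak t],$$ where in each summand $U\subset\mathfrak t$ is a real subspace with $U\cap iU=0$ (so that $U_{\mathbb C}=U\oplus iU\subset\mathfrak t$), $D$ is a differential operator with constant coefficients on $\mathbb C[\mathfrak t]$, $\eta\in\mathfrak t$, $dx$ is Lebesgue measure, and for some $\varepsilon>0$ the function $w$ is holomorphic on the tube $U\times B_\varepsilon(0)=\{u+iv: u,v\in U,\ |v|<\varepsilon\}\subset U_{\mathbb C}$ and decays exponentially there: $|w(z)|\le Ce^{-a|z|}$ on the tube for some constants $C$ and $a>0$. (2) Suppose moreover that $e^{2\pi i\zeta(\lambda)}$ is not a positive real number different from $1$ for any primitive $\lambda\in Y$ whose line $\mathbb C\lambda$ is an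 intersection of hyperplanes $\xi_j=0$ (the empty intersection being $\mathfrak t$); this holds for instance if $\zeta$ is real-valued. Then there is such a sum in which all the subspaces $U$ are contained in $\mathfrak t_{\mathbb R}$. -/

import Mathlib

open MeasureTheory

/-! Coordinates: the torus is `(ℂˣ)^d`, its cocharacter lattice is `Y = ℤ^d`, its Lie algebra is
`𝔱 = ℂ^d ⊇ 𝔱_ℝ = ℝ^d`, and `ℂ[𝔱]` is the polynomial ring in `d` variables. -/

namespace AbelianCoulomb

/-- The Lie algebra `𝔱 = ℂ^d`, with its Euclidean norm. -/
abbrev LieAlg (d : ℕ) : Type := EuclideanSpace ℂ (Fin d)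

/-- The value `ξ(λ) ∈ ℤ` of a character `ξ` on a cocharacter `l`. -/
def pairing {d : ℕ} (xi l : Fin d → ℤ) : ℤ := ∑ k, xi k * l k

/-- A character `ξ` regarded as a linear function on `𝔱`, i.e. as an element of `ℂ[𝔱]`. -/
noncomputable def linearForm {d : ℕ} (xi : Fin d → ℤ) : MvPolynomial (Fin d) ℂ :=
  ∑ k, MvPolynomial.C (xi k : ℂ) * MvPolynomial.X k

/-- The shift automorphism `(S_λ f)(z) = f(z + λ)` of `ℂ[𝔱]`. -/
noncomputable def shift {d : ℕ} (l : Fin d → ℤ) :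
    MvPolynomial (Fin d) ℂ →ₐ[ℂ] MvPolynomial (Fin d) ℂ :=
  MvPolynomial.aeval fun k => MvPolynomial.X k + MvPolynomial.C (l k : ℂ)

/-- The contribution of one weight `ξ` with flavour `b` to the product `r^λ r^μ`.
With `p = ξ(λ)`, `q = ξ(μ)` and `m = min(|p|, |q|)` it is
`∏_{j=1}^m (ξ + b + p - j + 1/2)` if `p > 0 > q`, it is
`∏_{j=1}^m (ξ + b + p + j - 1/2)` if `p < 0 < q`, and it is `1` otherwise. -/
noncomputable def structureFactor {d : ℕ} (xi : Fin d → ℤ) (b : ℂ) (l m : Fin d → ℤ) :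
    MvPolynomial (Fin d) ℂ :=
  let p := pairing xi l
  let q := pairing xi m
  if 0 < p ∧ q < 0 then
    ∏ j ∈ Finset.Icc 1 (min p.natAbs q.natAbs),
      (linearForm xi + MvPolynomial.C (b + (p : ℂ) - (j : ℂ) + 1 / 2))
  else if p < 0 ∧ 0 < q then
    ∏ j ∈ Finset.Icc 1 (min p.natAbs q.natAbs),
      (linearForm xi + MvPolynomial.C (b + (p : ℂ) + (j : ℂ) - 1 / 2))
  else 1

/-- The underlying space of the quantized abelian Coulomb branch: the free `ℂ[𝔱]`-module on the
symbols `r^λ`, `λ ∈ Y`. The element `f r^λ` is `Finsupp.single l f`; the subalgebra `ℂ[𝔱]` consists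
of the elements `f r^0`. -/
abbrev Branch (d : ℕ) : Type := (Fin d → ℤ) →₀ MvPolynomial (Fin d) ℂ

/-- The product of the quantized abelian Coulomb branch with weights `ξ_1, …, ξ_n` and flavours
`b_1, …, b_n`: `(f r^λ)(h r^μ) = f S_λ(h) (∏_i A_i(λ,μ)) r^{λ+μ}`. -/
noncomputable def mul {d n : ℕ} (xi : Fin n → Fin d → ℤ) (b : Fin n → ℂ) (x y : Branch d) :
    Branch d :=
  x.sum fun l f => y.sum fun m h =>
    Finsupp.single (l + m) (f * shift l h * ∏ i, structureFactor (xi i) (b i) l m)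

/-- The number `e^{2π i ζ(λ)}`, for `ζ ∈ Hom(Y, ℂ)`. -/
noncomputable def twistFactor {d : ℕ} (zeta : Fin d → ℂ) (l : Fin d → ℤ) : ℂ :=
  Complex.exp (2 * Real.pi * Complex.I * ∑ k, zeta k * (l k : ℂ))

/-- The automorphism `g = e^{2π i ζ}`: `g(f r^λ) = e^{2π i ζ(λ)} f r^λ`. -/
noncomputable def twist {d : ℕ} (zeta : Fin d → ℂ) (x : Branch d) : Branch d :=
  x.sum fun l f => Finsupp.single l (twistFactor zeta l • f)

/-- `T` is a `g`-twisted trace: `T(ab) = T(b g(a))`, where `g = e^{2π i ζ}`. -/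
def IsTwistedTrace {d n : ℕ} (xi : Fin n → Fin d → ℤ) (b : Fin n → ℂ) (zeta : Fin d → ℂ)
    (T : Branch d →ₗ[ℂ] ℂ) : Prop :=
  ∀ x y : Branch d, T (mul xi b x y) = T (mul xi b y (twist zeta x))

/-- The real form `𝔱_ℝ = ℝ^d` of `𝔱`. -/
def realForm (d : ℕ) : Submodule ℝ (LieAlg d) where
  carrier := {z | ∀ k, (z k).im = 0}
  add_mem' := by
    intro a c ha hc k
    simp [ha k, hc k]
  zero_mem' := by
    intro k
    simp
  smul_mem' := by
    intro r a ha k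
    simp [ha k]

/-- The differential operators with constant coefficients on `ℂ[𝔱]`. -/
noncomputable def constCoeffDiffOps (d : ℕ) :
    Subalgebra ℂ (Module.End ℂ (MvPolynomial (Fin d) ℂ)) :=
  Algebra.adjoin ℂ (Set.range fun k => (MvPolynomial.pderiv (R := ℂ) k).toLinearMap)

/-- The tube `U × B_ε(0) = {u + i v : u, v ∈ U, |v| < ε}`; if `U ∩ iU = 0` this is an open
neighbourhood of `U` in the complexification `U_ℂ = U ⊕ iU ⊆ 𝔱`. -/
def tube {d : ℕ} (U : Submodule ℝ (LieAlg d)) (eps : ℝ) : Set (LieAlg d) :=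
  {z | ∃ u ∈ U, ∃ v ∈ U, ‖v‖ < eps ∧ z = u + Complex.I • v}

/-- The Lebesgue measure of the Euclidean space `U`. -/
noncomputable def lebesgue {d : ℕ} (U : Submodule ℝ (LieAlg d)) : Measure U :=
  (stdOrthonormalBasis ℝ U).toBasis.addHaar

/-- The data `(U, D, η, w)` of one summand. Differentiability of `w` on the tube, a relatively open
subset of the complex subspace `U_ℂ`, is holomorphy of `w` as a function on that subset of `U_ℂ`. -/
structure IntegralTerm (d : ℕ) where
  /-- a real subspace of `𝔱` -/
  U : Submodule ℝ (LieAlg d)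
  /-- `U ∩ iU = 0`, so that `U_ℂ = U ⊕ iU` is the complexification of `U` -/
  totallyReal : ∀ u ∈ U, Complex.I • u ∈ U → u = 0
  /-- a differential operator -/
  D : Module.End ℂ (MvPolynomial (Fin d) ℂ)
  D_mem : D ∈ constCoeffDiffOps d
  /-- the shift of the domain of integration -/
  eta : LieAlg d
  eps : ℝ
  eps_pos : 0 < eps
  /-- the weight; only its values on the tube matter -/
  w : LieAlg d → ℂ
  holomorphic : DifferentiableOn ℂ w (tube U eps)
  decay : ∃ C a : ℝ, 0 < a ∧ ∀ z ∈ tube U eps, ‖w z‖ ≤ C * Real.exp (-a * ‖z‖)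

/-- `∫_{U + iη} (D R)(i x) w(x - iη) dx`, parametrized by `x = u + iη` with `u ∈ U`. -/
noncomputable def IntegralTerm.value {d : ℕ} (t : IntegralTerm d)
    (R : MvPolynomial (Fin d) ℂ) : ℂ :=
  ∫ u : t.U, MvPolynomial.eval
    (fun k => (Complex.I • ((u : LieAlg d) + Complex.I • t.eta)) k) (t.D R) * t.w (u : LieAlg d)
    ∂(lebesgue t.U)

/-- `λ ∈ Y` is a primitive vector whose line `ℂλ` is an intersection of hyperplanes `ξ_j = 0`
(the whole space being the empty intersection). -/
def SpansFlat {d n : ℕ} (xi : Fin n → Fin d → ℤ) (l : Fin d → ℤ) : Prop :=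
  l ≠ 0 ∧ (∀ (c : ℤ) (m : Fin d → ℤ), l = c • m → IsUnit c) ∧
    ∀ v : Fin d → ℂ, (∀ j, pairing (xi j) l = 0 → ∑ k, (xi j k : ℂ) * v k = 0) →
      ∃ c : ℂ, ∀ k, v k = c * (l k : ℂ)

/-- `T` restricted to `ℂ[𝔱]` is the sum of the given finitely many integrals. -/
def IsSumOfIntegrals {d N : ℕ} (T : Branch d →ₗ[ℂ] ℂ) (t : Fin N → IntegralTerm d) : Prop :=
  ∀ R : MvPolynomial (Fin d) ℂ, T (Finsupp.single 0 R) = ∑ k, (t k).value R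

end AbelianCoulomb

/-! Everything is read off the generating function F(y) = T(e^{c⟨y,z⟩}) of the restriction of T to
ℂ[𝔱], where c is a fixed complex number with |c| = 1 and Re c > 0. A priori F is only a formal power
series. The shift S_{-λ} multiplies e^{c⟨y,z⟩} by e^{-c⟨λ,y⟩}, so composing T with 1 - q S_{-λ}
multiplies F by 1 - q e^{-c⟨λ,y⟩} (`momentSeries_comp_quasiDifference`).

The trace identity for f r^λ and r^{-λ} says that, for q = e^{2πiζ(λ)}, the functional T ∘ (1 - q
S_{-λ}) kills an ideal generated by a product of factors ξ_i + a with ξ_i(λ) ≠ 0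
(`IsTwistedTrace.isTransverse`). Compose T with these operators for enough λ spanning
one-dimensional flats of the arrangement. Modulo a prime ideal in the annihilator locus the weights
that become constant then have no common zero, so all coordinates are constant: the resulting
functional factors through a finite-dimensional algebra (`finite_quotient_kernelIdeal`). Its
generating function is a matrix coefficient of an exponential, hence entire of exponential growth.

To recover F one divides by the factors 1 - q e^{-c⟨λ,y⟩}. If the only possible real zero of 1 - q
e^{-cx} is x = 0, this can be done on a tube around ℝ^d without losing holomorphy or exponential
growth; when q = 1 the zero on ⟨λ,y⟩ = 0 is cancelled because the numerator vanishes there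
(`HasTameGenerating.of_comp_quasiDifference`). A generic c meets the condition for all λ, which
gives (1); under the positivity hypothesis of (2), c = 1 does.

Finally F is divided by ∏ 2cosh(K y_k) with K large. The quotient decays exponentially on a tube, so
it is the Fourier transform of a weight w with the same properties. Expanding the product of cosines
into exponentials e^{K⟨s,y⟩}, s ∈ {±1}^d, gives T(R) = Σ_s ∫ R(c⁻¹(ix + Ks)) w(x) dx
(`HasTameGenerating.exists_contourIntegral`). These are integrals over translates of U = c⁻¹ℝ^d,
with D = 1 throughout.

If the weights do not span, some λ ≠ 0 is killed by all of them, the annihilating product is empty,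
and T vanishes on ℂ[𝔱]. -/

namespace AbelianCoulomb

/-! ### Holomorphic dependence on parameters -/

/-- A parametric integral of functions that depend holomorphically on a parameter in a
finite-dimensional space is holomorphic. -/
theorem differentiableOn_integral_of_dominated {E α : Type*} [NormedAddCommGroup E]
    [NormedSpace ℂ E] [FiniteDimensional ℂ E] [MeasurableSpace α] {μ : Measure α} {O : Set E}
    (hO : IsOpen O) {f : E → α → ℂ} {g : α → ℝ}
    (hd : ∀ a, DifferentiableOn ℂ (fun η => f η a) O)
    (hm : ∀ η ∈ O, AEStronglyMeasurable (f η) μ)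
    (hg : Integrable g μ) (hb : ∀ η ∈ O, ∀ a, ‖f η a‖ ≤ g a) :
    DifferentiableOn ℂ (fun η => ∫ a, f η a ∂μ) O := by
  intro x hx
  obtain ⟨r, hr, hball⟩ := Metric.isOpen_iff.1 hO x hx
  have hdiff : ∀ a, ∀ y ∈ Metric.ball x (r / 2),
      HasFDerivAt (fun η => f η a) (fderiv ℂ (fun η => f η a) y) y := by
    intro a y hy
    have hyO : y ∈ O := hball (Metric.ball_subset_ball (by linarith) hy)
    exact ((hd a).differentiableAt (hO.mem_nhds hyO)).hasFDerivAt
  -- Cauchy's estimate on the ball of radius r/2 about y, where f varies by at most 2 g(a).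
  have hbound : ∀ a, ∀ y ∈ Metric.ball x (r / 2),
      ‖fderiv ℂ (fun η => f η a) y‖ ≤ (2 * g a) / (r / 2) := by
    intro a y hy
    have hsub : Metric.ball y (r / 2) ⊆ O := by
      refine Set.Subset.trans (fun z hz => ?_) hball
      rw [Metric.mem_ball] at *
      linarith [dist_triangle z y x]
    refine Complex.norm_fderiv_le_div_of_mapsTo_ball ((hd a).mono hsub) ?_ (by linarith)
    intro z hz
    rw [Metric.mem_closedBall, dist_eq_norm]
    have h1 := hb z (hsub hz) a
    have h2 := hb y (hsub (Metric.mem_ball_self (by linarith))) a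
    linarith [norm_sub_le (f z a) (f y a)]
  -- Each directional derivative is a pointwise limit of difference quotients with steps 1/(n+1),
  -- which are measurable once the displaced point lies in O; the index is shifted by N to ensure
  -- this.
  have hmeas : AEStronglyMeasurable (fun a => fderiv ℂ (fun η => f η a) x) μ := by
    let b := Module.finBasis ℂ E
    have hcoord : ∀ i, AEStronglyMeasurable (fun a => fderiv ℂ (fun η => f η a) x (b i)) μ := by
      intro i
      have hc : Filter.Tendsto (fun n : ℕ => ‖((n : ℂ) + 1)‖) Filter.atTop Filter.atTop := by
        have : ∀ n : ℕ, ‖((n : ℂ) + 1)‖ = (n : ℝ) + 1 := fun n => by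
          rw [← Nat.cast_succ, Complex.norm_natCast, Nat.cast_succ]
        simp only [this]
        exact Filter.tendsto_atTop_add_const_right _ _ tendsto_natCast_atTop_atTop
      have hu : Filter.Tendsto (fun n : ℕ => x + ((n : ℂ) + 1)⁻¹ • b i) Filter.atTop
          (nhds x) := by
        have h0 : Filter.Tendsto (fun n : ℕ => ((n : ℂ) + 1)⁻¹) Filter.atTop (nhds 0) := by
          simpa using (tendsto_one_div_add_atTop_nhds_zero_nat (𝕜 := ℂ))
        simpa using tendsto_const_nhds.add (h0.smul_const (b i))
      obtain ⟨N, hN⟩ := Filter.eventually_atTop.1 (hu.eventually (hO.mem_nhds hx))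
      refine aestronglyMeasurable_of_tendsto_ae Filter.atTop
        (f := fun (n : ℕ) a => (((n + N : ℕ) : ℂ) + 1) •
          (f (x + (((n + N : ℕ) : ℂ) + 1)⁻¹ • b i) a - f x a)) ?_ ?_
      · intro n
        exact ((hm _ (hN (n + N) (Nat.le_add_left N n))).sub (hm _ hx)).const_smul (((n + N : ℕ) : ℂ) + 1)
      · refine Filter.Eventually.of_forall fun a => ?_
        exact ((hdiff a x (Metric.mem_ball_self (by linarith))).lim (b i) hc).comp
          (Filter.tendsto_add_atTop_nat N)
    have : (fun a => fderiv ℂ (fun η => f η a) x) = fun a => ∑ i,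
        (fderiv ℂ (fun η => f η a) x (b i)) • (LinearMap.toContinuousLinearMap (b.coord i)) := by
      funext a
      ext v
      conv_lhs => rw [← b.sum_repr v]
      simp only [map_sum, map_smul, _root_.sum_apply, _root_.smul_apply,
        LinearMap.coe_toContinuousLinearMap', Module.Basis.coord_apply, smul_eq_mul, mul_comm]
    rw [this]
    exact Finset.aestronglyMeasurable_fun_sum _ fun i _ => (hcoord i).smul_const _
  have hint : Integrable (f x) μ :=
    Integrable.mono' hg (hm x hx) (Filter.Eventually.of_forall (hb x hx))
  exact (hasFDerivAt_integral_of_dominated_of_fderiv_le (Metric.ball_mem_nhds x (by linarith))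
    (Filter.Eventually.mono (hO.mem_nhds hx) hm) hint hmeas
    (Filter.Eventually.of_forall hbound) ((hg.const_mul 2).div_const _)
    (Filter.Eventually.of_forall hdiff)).differentiableAt.differentiableWithinAt

/-- The Taylor coefficients of a holomorphic function along a line depend holomorphically on the
line. -/
theorem differentiableOn_iteratedDeriv_line {E : Type*} [NormedAddCommGroup E]
    [NormedSpace ℂ E] [FiniteDimensional ℂ E] {O : Set E} (hO : IsOpen O) {f : E → ℂ}
    (hf : DifferentiableOn ℂ f O) (n : ℕ) :
    DifferentiableOn ℂ (fun p : E × E => iteratedDeriv n (fun t : ℂ => f (p.1 + t • p.2)) 0)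
      (O ×ˢ Set.univ) := by
  rintro ⟨z₀, v₀⟩ ⟨hz₀, -⟩
  obtain ⟨R, hR, hball⟩ := Metric.isOpen_iff.1 hO z₀ hz₀
  obtain ⟨M, hM⟩ : ∃ M, ∀ z ∈ Metric.closedBall z₀ (R / 2), ‖f z‖ ≤ M := by
    have : ProperSpace E := FiniteDimensional.proper ℂ E
    exact (isCompact_closedBall z₀ (R / 2)).exists_bound_of_continuousOn
      (hf.continuousOn.mono ((Metric.closedBall_subset_ball (by linarith)).trans hball))
  set B := ‖v₀‖ + 1 with hB
  have hBpos : 0 < B := by positivity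
  -- With |t| ≤ r and |v| ≤ B the displacement t v is at most R/4, so z + t v stays in the compact
  -- ball of radius R/2.
  set r := R / (4 * B) with hr
  have hrpos : 0 < r := by positivity
  have hrB : r * B = R / 4 := by rw [hr]; field_simp
  set W := Metric.ball z₀ (R / 4) ×ˢ Metric.ball v₀ 1 with hW
  have hWo : IsOpen W := Metric.isOpen_ball.prod Metric.isOpen_ball
  have hmem : ∀ p ∈ W, ∀ t : ℂ, ‖t‖ ≤ r → p.1 + t • p.2 ∈ Metric.closedBall z₀ (R / 2) := by
    rintro ⟨z, v⟩ ⟨hz, hv⟩ t ht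
    simp only [Metric.mem_ball, Metric.mem_closedBall, dist_eq_norm] at *
    have h1 : ‖v‖ ≤ B := by
      have := norm_add_le (v - v₀) v₀
      simp only [sub_add_cancel] at this
      linarith
    have h2 : ‖t • v‖ ≤ R / 4 := by
      rw [norm_smul, ← hrB]
      gcongr
    have h3 := norm_add_le (z - z₀) (t • v)
    rw [show z + t • v - z₀ = z - z₀ + t • v by abel]
    linarith
  have hsubO : Metric.closedBall z₀ (R / 2) ⊆ O :=
    (Metric.closedBall_subset_ball (by linarith)).trans hball
  have hcl : ∀ θ : ℝ, ‖circleMap 0 r θ‖ ≤ r := fun θ => by simp [abs_of_pos hrpos]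
  -- The Cauchy integral for the n-th derivative over a circle of fixed radius r, written as a
  -- parametric integral.
  have key : DifferentiableOn ℂ (fun p : E × E => ∫ θ in Set.Ioc 0 (2 * Real.pi),
      deriv (circleMap 0 r) θ • ((1 / (circleMap 0 r θ - 0) ^ (n + 1)) •
        f (p.1 + circleMap 0 r θ • p.2))) W := by
    refine differentiableOn_integral_of_dominated hWo
      (g := fun _ => r * ((1 / r ^ (n + 1)) * M)) ?_ ?_ ?_ ?_
    · intro θ
      have : DifferentiableOn ℂ (fun p : E × E => f (p.1 + circleMap 0 r θ • p.2)) W :=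
        hf.comp (by fun_prop) fun p hp => hsubO (hmem p hp _ (hcl θ))
      exact (this.const_smul (1 / (circleMap 0 r θ - 0) ^ (n + 1))).const_smul
        (deriv (circleMap 0 r) θ)
    · intro p hp
      refine Continuous.aestronglyMeasurable ?_
      simp only [deriv_circleMap, sub_zero, smul_eq_mul]
      refine Continuous.mul ((continuous_circleMap 0 r).mul continuous_const)
        (Continuous.mul ?_ ?_)
      · refine continuous_const.div (by fun_prop) fun θ => ?_
        simp [hrpos.ne']
      · exact hf.continuousOn.comp_continuous (f := fun θ => p.1 + circleMap 0 r θ • p.2)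
          (by fun_prop) fun θ => hsubO (hmem p hp _ (hcl θ))
    · exact integrable_const _
    · intro p hp θ
      have h1 := hM _ (hmem p hp _ (hcl θ))
      rw [norm_smul, norm_smul]
      simp only [deriv_circleMap, sub_zero, norm_mul, norm_circleMap_zero, Complex.norm_I, mul_one,
        norm_div, norm_one, norm_pow, abs_of_pos hrpos]
      gcongr
  have hpW : ((z₀, v₀) : E × E) ∈ W :=
    ⟨Metric.mem_ball_self (by positivity), Metric.mem_ball_self one_pos⟩
  have heq : ∀ p ∈ W, iteratedDeriv n (fun t : ℂ => f (p.1 + t • p.2)) 0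
      = (2 * Real.pi * Complex.I / n.factorial)⁻¹ • ∫ θ in Set.Ioc 0 (2 * Real.pi),
      deriv (circleMap 0 r) θ • ((1 / (circleMap 0 r θ - 0) ^ (n + 1)) •
        f (p.1 + circleMap 0 r θ • p.2)) := by
    intro p hp
    have hdl : DifferentiableOn ℂ (fun t : ℂ => f (p.1 + t • p.2)) (Metric.closedBall 0 r) :=
      hf.comp (by fun_prop) fun t ht => hsubO (hmem p hp t (by simpa using ht))
    have := DiffContOnCl.circleIntegral_one_div_sub_center_pow_smul hrpos n
      (hdl.diffContOnCl_ball Set.Subset.rfl)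
    rw [← intervalIntegral.integral_of_le (by positivity)]
    rw [eq_inv_smul_iff₀ (by simp [Nat.factorial_ne_zero, Real.pi_ne_zero])]
    exact this.symm
  exact (((key.const_smul (2 * Real.pi * Complex.I / n.factorial)⁻¹).congr heq).differentiableAt
    (hWo.mem_nhds hpW)).differentiableWithinAt

/-! ### Moments along linear forms and formal generating series -/

/-- The element `c ∑ y_k z_k` of `ℂ[𝔱]`. -/
noncomputable def scaledForm {d : ℕ} (c : ℂ) (y : LieAlg d) : MvPolynomial (Fin d) ℂ :=
  ∑ k, MvPolynomial.C (c * y k) * MvPolynomial.X k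

/-- A character of `Y` extended to a complex linear form on `𝔱`. -/
noncomputable def coweightForm {d : ℕ} (l : Fin d → ℤ) : LieAlg d →L[ℂ] ℂ :=
  ∑ k, (l k : ℂ) • EuclideanSpace.proj k

theorem coweightForm_apply {d : ℕ} (l : Fin d → ℤ) (y : LieAlg d) :
    coweightForm l y = ∑ k, (l k : ℂ) * y k := by
  simp [coweightForm, _root_.sum_apply]

/-- The operator `1 - q S_{-λ}` on `ℂ[𝔱]`. -/
noncomputable def quasiDifference {d : ℕ} (q : ℂ) (l : Fin d → ℤ) :
    MvPolynomial (Fin d) ℂ →ₗ[ℂ] MvPolynomial (Fin d) ℂ :=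
  LinearMap.id - q • (shift (-l)).toLinearMap

theorem shift_scaledForm {d : ℕ} (c : ℂ) (l : Fin d → ℤ) (y : LieAlg d) :
    shift (-l) (scaledForm c y) =
      scaledForm c y + MvPolynomial.C (-(c * coweightForm l y)) := by
  simp only [shift, scaledForm, map_sum, map_mul, MvPolynomial.aeval_X, coweightForm_apply,
    MvPolynomial.algHom_C, mul_add, Finset.sum_add_distrib, Finset.mul_sum, MvPolynomial.algebraMap_eq]
  congr 1
  rw [← Finset.sum_neg_distrib, map_sum]
  refine Finset.sum_congr rfl fun k _ => ?_
  simp only [← map_mul, Pi.neg_apply, Int.cast_neg]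
  congr 1
  ring

/-- The homogeneous polynomial `y ↦ T((c ∑ y_k z_k)^n)`. -/
noncomputable def powerPolynomial {d : ℕ} (c : ℂ) (T : MvPolynomial (Fin d) ℂ →ₗ[ℂ] ℂ) (n : ℕ) :
    MvPolynomial (Fin d) ℂ :=
  ∑ a ∈ Finset.piAntidiag Finset.univ n, MvPolynomial.monomial (Finsupp.equivFunOnFinite.symm a)
    (Nat.multinomial Finset.univ a * c ^ n *
      T (MvPolynomial.monomial (Finsupp.equivFunOnFinite.symm a) 1))

theorem monomial_equivFunOnFinite {d : ℕ} (a : Fin d → ℕ) :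
    MvPolynomial.monomial (Finsupp.equivFunOnFinite.symm a) (1 : ℂ)
      = ∏ k, MvPolynomial.X k ^ a k := by
  rw [MvPolynomial.monomial_eq, Finsupp.prod_fintype _ _ (by simp)]
  simp

/-- The multinomial theorem. It makes the moments polynomial in y, which is used both for continuity
in y and for recovering T from them. -/
theorem apply_scaledForm_pow {d : ℕ} (c : ℂ) (T : MvPolynomial (Fin d) ℂ →ₗ[ℂ] ℂ) (n : ℕ)
    (y : LieAlg d) :
    T (scaledForm c y ^ n) = MvPolynomial.eval (fun k => y k) (powerPolynomial c T n) := by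
  rw [scaledForm, Finset.sum_pow_eq_sum_piAntidiag, powerPolynomial, map_sum, map_sum]
  refine Finset.sum_congr rfl fun a ha => ?_
  have hn : c ^ n = ∏ k, c ^ a k := by
    rw [Finset.prod_pow_eq_pow_sum]
    simp [(Finset.mem_piAntidiag.1 ha).1]
  rw [MvPolynomial.eval_monomial, Finsupp.prod_fintype _ _ (by simp), monomial_equivFunOnFinite]
  have : (Nat.multinomial Finset.univ a : MvPolynomial (Fin d) ℂ) *
      ∏ k, (MvPolynomial.C (c * y k) * MvPolynomial.X k) ^ a k =
      ((Nat.multinomial Finset.univ a : ℂ) * ∏ k, (c * y k) ^ a k) •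
        ∏ k, MvPolynomial.X k ^ a k := by
    simp only [mul_pow, Finset.prod_mul_distrib, MvPolynomial.smul_eq_C_mul, map_mul, map_prod,
      map_pow, map_natCast]
    ring
  rw [this, map_smul, smul_eq_mul, hn]
  simp only [mul_pow, Finset.prod_mul_distrib, Finsupp.equivFunOnFinite_symm_apply_apply]
  ring

theorem continuous_apply_scaledForm_pow {d : ℕ} (c : ℂ) (T : MvPolynomial (Fin d) ℂ →ₗ[ℂ] ℂ)
    (n : ℕ) : Continuous fun y : LieAlg d => T (scaledForm c y ^ n) := by
  simp only [apply_scaledForm_pow]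
  exact (MvPolynomial.continuous_eval _).comp (by fun_prop)

/-- Powers of real linear forms span `ℂ[𝔱]`. -/
theorem eq_of_scaledForm_pow_eq {d : ℕ} {c : ℂ} (hc : c ≠ 0)
    {T S : MvPolynomial (Fin d) ℂ →ₗ[ℂ] ℂ}
    (h : ∀ (y : LieAlg d) (n : ℕ), y ∈ realForm d → T (scaledForm c y ^ n) = S (scaledForm c y ^ n)) :
    T = S := by
  rw [← sub_eq_zero]
  set D := T - S with hD
  have hz : ∀ n, powerPolynomial c D n = 0 := by
    intro n
    -- A polynomial vanishing on ℝ^d is zero, so real y suffice.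
    refine MvPolynomial.funext_set (s := fun _ => Set.range ((↑) : ℝ → ℂ)) 
      (hs := fun _ => Set.infinite_range_of_injective Complex.ofReal_injective) fun x hx => ?_
    have hy : (WithLp.toLp 2 x : LieAlg d) ∈ realForm d := by
      intro k
      obtain ⟨r, hr⟩ := hx k trivial
      simp [← hr]
    have := apply_scaledForm_pow c D n (WithLp.toLp 2 x)
    rw [hD, LinearMap.sub_apply, h _ _ hy, sub_self] at this
    simpa using this.symm
  ext m
  change D (MvPolynomial.monomial m 1) = 0
  -- The coefficient of y^m is a nonzero multiple (multinomial coefficient times a power of c) of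
  -- the value on z^m.
  have hm := congrArg (MvPolynomial.coeff m) (hz (∑ k, m k))
  rw [powerPolynomial, MvPolynomial.coeff_sum, Finset.sum_eq_single (⇑m)] at hm
  · have e : Finsupp.equivFunOnFinite.symm (⇑m) = m := by ext; simp
    rw [e, MvPolynomial.coeff_monomial, if_pos rfl, MvPolynomial.coeff_zero] at hm
    simpa [hc, Nat.multinomial_pos, (Nat.multinomial_pos _ _).ne'] using hm
  · intro b _ hb
    rw [MvPolynomial.coeff_monomial, if_neg]
    rintro rfl
    simp at hb
  · intro hm'
    simp at hm'

/-- The Taylor series at `0`. -/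
noncomputable def taylorSeries (f : ℂ → ℂ) : PowerSeries ℂ :=
  PowerSeries.mk fun n => iteratedDeriv n f 0 / n.factorial

/-- Binomial convolution of sequences is the Cauchy product of their exponential generating
functions; this serves both the Leibniz rule and the binomial expansion of a shifted power. -/
theorem sum_choose_div_factorial (n : ℕ) (u v : ℕ → ℂ) :
    (∑ i ∈ Finset.range (n + 1), (n.choose i : ℂ) * u i * v (n - i)) / n.factorial =
      ∑ p ∈ Finset.HasAntidiagonal.antidiagonal n, (u p.1 / p.1.factorial) * (v p.2 / p.2.factorial) := by
  rw [Finset.Nat.sum_antidiagonal_eq_sum_range_succ_mk, Finset.sum_div]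
  refine Finset.sum_congr rfl fun i hi => ?_
  have hi' : i ≤ n := Nat.lt_succ_iff.1 (Finset.mem_range.1 hi)
  rw [Nat.cast_choose ℂ hi']
  have := Nat.factorial_ne_zero n
  have := Nat.factorial_ne_zero i
  have := Nat.factorial_ne_zero (n - i)
  field_simp

theorem taylorSeries_mul {f g : ℂ → ℂ} (hf : AnalyticAt ℂ f 0) (hg : AnalyticAt ℂ g 0) :
    taylorSeries (fun t => f t * g t) = taylorSeries f * taylorSeries g := by
  ext n
  rw [PowerSeries.coeff_mul]
  simp only [taylorSeries, PowerSeries.coeff_mk]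
  rw [iteratedDeriv_fun_mul hf.contDiffAt hg.contDiffAt]
  exact sum_choose_div_factorial n (fun i => iteratedDeriv i f 0) fun i => iteratedDeriv i g 0

/-- The Taylor series of `t ↦ 1 - q e^{-at}`. -/
theorem taylorSeries_one_sub_exp (q a : ℂ) :
    taylorSeries (fun t => 1 - q * Complex.exp (-a * t)) =
      1 - PowerSeries.mk fun n => q * ((-a) ^ n / n.factorial) := by
  ext n
  simp only [taylorSeries, map_sub, PowerSeries.coeff_mk, PowerSeries.coeff_one]
  have h2 : iteratedDeriv n (fun t => q * Complex.exp (-a * t)) 0 = q * (-a) ^ n := by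
    rw [iteratedDeriv_const_mul_field, iteratedDeriv_cexp_const_mul]
    simp
  have h : iteratedDeriv n (fun t => 1 - q * Complex.exp (-a * t)) 0
      = (if n = 0 then 1 else 0) - q * (-a) ^ n := by
    rw [← h2]
    have := iteratedDeriv_sub (n := n) (x := (0 : ℂ)) (f := fun _ : ℂ => (1 : ℂ))
      (g := fun t => q * Complex.exp (-a * t)) (by fun_prop) (by fun_prop)
    rw [← show iteratedDeriv n (fun _ : ℂ => (1 : ℂ)) 0 = if n = 0 then 1 else 0 by
      simp [iteratedDeriv_const], ← this]
    rfl
  rw [h, sub_div]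
  congr 1
  · split_ifs with hn <;> simp [hn]
  · ring

/-- The constant coefficient is 1 - q and the linear one is qa; for a ≠ 0 they cannot both vanish.
-/
theorem one_sub_exp_series_ne_zero {q a : ℂ} (ha : a ≠ 0) :
    (1 - PowerSeries.mk fun n => q * ((-a) ^ n / n.factorial) : PowerSeries ℂ) ≠ 0 := by
  intro h
  have h0 := congrArg (PowerSeries.coeff 0) h
  have h1 := congrArg (PowerSeries.coeff 1) h
  simp [PowerSeries.coeff_one, sub_eq_zero] at h0 h1
  simp [← h0, ha] at h1

/-- The exponential generating function of the values of `T` on the powers of a linear form. -/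
noncomputable def momentSeries {d : ℕ} (c : ℂ) (T : MvPolynomial (Fin d) ℂ →ₗ[ℂ] ℂ)
    (y : LieAlg d) : PowerSeries ℂ :=
  PowerSeries.mk fun n => T (scaledForm c y ^ n) / n.factorial

/-- The shift adds the constant -c⟨λ,y⟩ to the linear form c⟨y,z⟩, hence multiplies its exponential
by e^{-c⟨λ,y⟩}. This turns the difference equation for T into a multiplicative one for its
generating series. -/
theorem momentSeries_comp_quasiDifference {d : ℕ} (c q : ℂ) (l : Fin d → ℤ)
    (T : MvPolynomial (Fin d) ℂ →ₗ[ℂ] ℂ) (y : LieAlg d) :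
    momentSeries c (T ∘ₗ quasiDifference q l) y =
      (1 - PowerSeries.mk fun n => q * ((-(c * coweightForm l y)) ^ n / n.factorial)) *
        momentSeries c T y := by
  ext n
  rw [sub_mul, one_mul, map_sub, mul_comm, PowerSeries.coeff_mul]
  simp only [momentSeries, PowerSeries.coeff_mk, LinearMap.comp_apply, quasiDifference,
    LinearMap.sub_apply, LinearMap.id_apply, LinearMap.smul_apply, AlgHom.toLinearMap_apply,
    map_pow, shift_scaledForm, map_sub, map_smul, smul_eq_mul, sub_div]
  congr 1
  have := sum_choose_div_factorial n (fun i => T (scaledForm c y ^ i))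
    (fun j => (-(c * coweightForm l y)) ^ j)
  calc _ = q * (T ((scaledForm c y + MvPolynomial.C (-(c * coweightForm l y))) ^ n)
      / n.factorial) := by ring
    _ = q * ((∑ i ∈ Finset.range (n + 1), (n.choose i : ℂ) * T (scaledForm c y ^ i) *
        (-(c * coweightForm l y)) ^ (n - i)) / n.factorial) := by
      congr 2
      rw [add_pow, map_sum]
      refine Finset.sum_congr rfl fun i _ => ?_
      have : scaledForm c y ^ i * MvPolynomial.C (-(c * coweightForm l y)) ^ (n - i) *
          (n.choose i : MvPolynomial (Fin d) ℂ) =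
          ((n.choose i : ℂ) * (-(c * coweightForm l y)) ^ (n - i)) • scaledForm c y ^ i := by
        simp only [MvPolynomial.smul_eq_C_mul, map_mul, map_pow, map_natCast]
        ring
      rw [this, map_smul, smul_eq_mul]
      ring
    _ = _ := by
      rw [this, Finset.mul_sum]
      refine Finset.sum_congr rfl fun p _ => by ring

/-! ### Tubes, generating functions and tameness -/

/-- The tube `{y : |Im y_k| < ε}` around `ℝ^d`. -/
def strip (d : ℕ) (eps : ℝ) : Set (LieAlg d) := {y | ∀ k, |(y k).im| < eps}

theorem strip_mono {d : ℕ} {e₁ e₂ : ℝ} (h : e₁ ≤ e₂) : strip d e₁ ⊆ strip d e₂ :=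
  fun _ hy k => (hy k).trans_le h

theorem isOpen_strip (d : ℕ) (eps : ℝ) : IsOpen (strip d eps) := by
  simp only [strip, Set.ofPred_forall]
  exact isOpen_iInter_of_finite fun k => isOpen_lt (by fun_prop) continuous_const

theorem zero_mem_strip (d : ℕ) {eps : ℝ} (h : 0 < eps) : (0 : LieAlg d) ∈ strip d eps := by
  intro k
  simpa using h

theorem convex_strip (d : ℕ) (eps : ℝ) : Convex ℝ (strip d eps) := by
  intro x hx y hy a b ha hb hab k
  have h : ((a • x + b • y) k).im = a * (x k).im + b * (y k).im := by simp
  rw [h]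
  have h1 := abs_lt.1 (hx k)
  have h2 := abs_lt.1 (hy k)
  rw [abs_lt]
  have e : b = 1 - a := by linarith
  rcases ha.eq_or_lt with rfl | ha'
  · simp only [zero_add] at hab
    simp [hab, h2]
  · constructor <;> nlinarith

theorem abs_im_coweightForm_le {d : ℕ} (l : Fin d → ℤ) {eps : ℝ} {y : LieAlg d}
    (hy : y ∈ strip d eps) : |(coweightForm l y).im| ≤ (∑ k, |(l k : ℝ)|) * eps := by
  rw [coweightForm_apply, Complex.im_sum, Finset.sum_mul]
  refine (Finset.abs_sum_le_sum_abs _ _).trans (Finset.sum_le_sum fun k _ => ?_)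
  have : ((l k : ℂ) * y k).im = (l k : ℝ) * (y k).im := by simp
  rw [this, abs_mul]
  exact mul_le_mul_of_nonneg_left (hy k).le (abs_nonneg _)

/-- `F` generates the values of `T` on powers of linear forms: `T(e^{c⟨y, z⟩}) = F(y)` as power
series in `y`. -/
def IsGenerating {d : ℕ} (c : ℂ) (T : MvPolynomial (Fin d) ℂ →ₗ[ℂ] ℂ) (F : LieAlg d → ℂ) : Prop :=
  ∀ (y : LieAlg d) (n : ℕ), iteratedDeriv n (fun t : ℂ => F (t • y)) 0 = T (scaledForm c y ^ n)

/-- `F` is holomorphic and of exponential growth on some tube around `ℝ^d`. -/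
def IsTame {d : ℕ} (F : LieAlg d → ℂ) : Prop :=
  ∃ eps C A : ℝ, 0 < eps ∧ 0 ≤ C ∧ 0 ≤ A ∧ DifferentiableOn ℂ F (strip d eps) ∧
    ∀ y ∈ strip d eps, ‖F y‖ ≤ C * Real.exp (A * ‖y‖)

theorem isOpen_line_strip {d : ℕ} (eps : ℝ) (y : LieAlg d) :
    IsOpen {t : ℂ | t • y ∈ strip d eps} :=
  (isOpen_strip d eps).preimage (by fun_prop)

theorem analyticOnNhd_line {d : ℕ} {eps : ℝ} {F : LieAlg d → ℂ}
    (hF : DifferentiableOn ℂ F (strip d eps)) (y : LieAlg d) :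
    AnalyticOnNhd ℂ (fun t : ℂ => F (t • y)) {t : ℂ | t • y ∈ strip d eps} :=
  DifferentiableOn.analyticOnNhd (hF.comp (by fun_prop) fun _ h => h) (isOpen_line_strip eps y)

/-- On the line through y, the Taylor series of G and the moment series of T solve the same linear
equation in the domain ℂ[[t]]. Its coefficient is nonzero when ⟨λ,y⟩ ≠ 0, so it cancels; the other y
follow by continuity. -/
theorem IsGenerating.of_mul {d : ℕ} {c q : ℂ} (hc : c ≠ 0) {l : Fin d → ℤ} (hl : l ≠ 0)
    {T : MvPolynomial (Fin d) ℂ →ₗ[ℂ] ℂ} {eps : ℝ} (heps : 0 < eps) {F G : LieAlg d → ℂ}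
    (hG : DifferentiableOn ℂ G (strip d eps))
    (hmul : ∀ y ∈ strip d eps, (1 - q * Complex.exp (-(c * coweightForm l y))) * G y = F y)
    (hF : IsGenerating c (T ∘ₗ quasiDifference q l) F) : IsGenerating c T G := by
  have h0 (y : LieAlg d) : (0 : ℂ) ∈ {t : ℂ | t • y ∈ strip d eps} := by
    simpa using zero_mem_strip d heps
  have hgen : ∀ y : LieAlg d, coweightForm l y ≠ 0 → ∀ n,
      iteratedDeriv n (fun t : ℂ => G (t • y)) 0 = T (scaledForm c y ^ n) := by
    intro y hy
    set a := c * coweightForm l y with ha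
    have hser : taylorSeries (fun t => (1 - q * Complex.exp (-a * t)) * G (t • y)) =
        momentSeries c (T ∘ₗ quasiDifference q l) y := by
      ext n
      simp only [taylorSeries, momentSeries, PowerSeries.coeff_mk, ← hF y n]
      congr 1
      refine Filter.EventuallyEq.iteratedDeriv_eq n ?_
      filter_upwards [(isOpen_line_strip eps y).mem_nhds (h0 y)] with t ht
      rw [← hmul _ ht, map_smul, ha, smul_eq_mul, mul_left_comm c t, mul_comm t, neg_mul]
    rw [taylorSeries_mul (by fun_prop) (analyticOnNhd_line hG y 0 (h0 y)), taylorSeries_one_sub_exp,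
      momentSeries_comp_quasiDifference] at hser
    have := mul_left_cancel₀ (one_sub_exp_series_ne_zero (mul_ne_zero hc hy)) hser
    intro n
    have hn := congrArg (PowerSeries.coeff n) this
    simp only [taylorSeries, momentSeries, PowerSeries.coeff_mk] at hn
    exact (div_left_inj' (mod_cast n.factorial_ne_zero)).1 hn
  intro y n
  by_cases hy : coweightForm l y ≠ 0
  · exact hgen y hy n
  -- Move y by s v with ⟨λ,v⟩ ≠ 0: for all s ≠ 0 the generic case applies, and both sides are
  -- continuous in s.
  push Not at hy
  obtain ⟨k, hk⟩ : ∃ k, l k ≠ 0 := by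
    by_contra! h
    exact hl (funext h)
  set v : LieAlg d := EuclideanSpace.single k 1
  have hv : coweightForm l v = l k := by
    simp [coweightForm_apply, v]
  have e1 : Continuous fun s : ℂ => T (scaledForm c (y + s • v) ^ n) :=
    (continuous_apply_scaledForm_pow c T n).comp (by fun_prop)
  have e2 : Continuous fun s : ℂ => iteratedDeriv n (fun t : ℂ => G (t • (y + s • v))) 0 := by
    have h := (differentiableOn_iteratedDeriv_line (isOpen_strip d eps) hG n).continuousOn
    have := h.comp_continuous (f := fun s : ℂ => ((0 : LieAlg d), y + s • v)) (by fun_prop)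
      fun s => ⟨zero_mem_strip d heps, trivial⟩
    simpa only [Function.comp_def, zero_add] using this
  have := e2.ext_on (dense_compl_singleton (0 : ℂ)) e1 (fun s hs => hgen _ (by
    rw [map_add, hy, map_smul, hv]
    simpa [hk] using hs) n)
  simpa using congrFun this 0

/-- When ⟨λ,y⟩ = 0 the form ⟨y,z⟩ is invariant under S_{-λ}, so 1 - S_{-λ} kills its powers and
every Taylor coefficient of F at 0 along the line vanishes. The identity theorem carries this to y,
the slice of the tube being convex. -/
theorem IsGenerating.eq_zero_of_coweightForm_eq_zero {d : ℕ} {c : ℂ} {l : Fin d → ℤ}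
    {T : MvPolynomial (Fin d) ℂ →ₗ[ℂ] ℂ} {eps : ℝ} (heps : 0 < eps) {F : LieAlg d → ℂ}
    (hd : DifferentiableOn ℂ F (strip d eps)) (hF : IsGenerating c (T ∘ₗ quasiDifference 1 l) F)
    {y : LieAlg d} (hy : y ∈ strip d eps) (hly : coweightForm l y = 0) : F y = 0 := by
  have hz : ∀ n, iteratedDeriv n (fun t : ℂ => F (t • y)) 0 = 0 := by
    intro n
    rw [hF]
    simp [quasiDifference, shift_scaledForm, hly]
  have ho := isOpen_line_strip eps y
  have h0 : (0 : ℂ) ∈ {t : ℂ | t • y ∈ strip d eps} := by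
    simpa using zero_mem_strip d heps
  obtain ⟨r, hr, hball⟩ := Metric.isOpen_iff.1 ho 0 h0
  have hev : (fun t : ℂ => F (t • y)) =ᶠ[nhds 0] 0 := by
    filter_upwards [Metric.ball_mem_nhds (0 : ℂ) hr] with t ht
    have := Complex.hasSum_taylorSeries_on_ball (f := fun t : ℂ => F (t • y)) (c := 0)
      (r := r) (((analyticOnNhd_line hd y).mono hball).differentiableOn) ht
    simp only [hz, smul_zero] at this
    exact this.unique hasSum_zero
  have hpre : IsPreconnected {t : ℂ | t • y ∈ strip d eps} := by
    refine Convex.isPreconnected ?_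
    exact (convex_strip d eps).is_linear_preimage
      ⟨fun a b => add_smul a b y, fun a b => smul_assoc a b y⟩
  have := (analyticOnNhd_line hd y).eqOn_zero_of_preconnected_of_eventuallyEq_zero hpre h0 hev
    (show (1 : ℂ) ∈ _ by simpa using hy)
  simpa using this

/-! ### Division by 1 - q e^{-c⟨λ,y⟩} -/

/-- Compactness gives a positive minimum near the segment [-M, M]; outside it the bound is assumed.
The loss e^{-|z|} leaves room for the quotient (1 - e^{-cz})/z, which is not bounded below at
infinity. -/
theorem exists_im_lt_lowerBound {k : ℂ → ℂ} (hk : Continuous k) (h0 : ∀ x : ℝ, k x ≠ 0) {M : ℝ}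
    (hM : ∀ z : ℂ, M ≤ |z.re| → |z.im| ≤ 1 → Real.exp (-‖z‖) / 2 ≤ ‖k z‖) :
    ∃ δ > 0, ∃ m > 0, ∀ z : ℂ, |z.im| < δ → m * Real.exp (-‖z‖) ≤ ‖k z‖ := by
  set S : Set ℂ := (fun x : ℝ => (x : ℂ)) '' Set.Icc (-M) M with hS
  have hSc : IsCompact S := isCompact_Icc.image Complex.continuous_ofReal
  have hopen : IsOpen {z | k z ≠ 0} := isOpen_ne_fun hk continuous_const
  obtain ⟨δ, hδ, hsub⟩ := hSc.exists_cthickening_subset_open hopen (by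
    rintro _ ⟨x, -, rfl⟩
    exact h0 x)
  have hcomp : IsCompact (Metric.cthickening δ S) := hSc.cthickening
  obtain ⟨m, hm, hmin⟩ : ∃ m > 0, ∀ z ∈ Metric.cthickening δ S, m ≤ ‖k z‖ := by
    rcases (Metric.cthickening δ S).eq_empty_or_nonempty with h | h
    · exact ⟨1, one_pos, by simp [h]⟩
    · obtain ⟨z, hz, hmin⟩ := hcomp.exists_isMinOn h hk.norm.continuousOn
      exact ⟨‖k z‖, norm_pos_iff.2 (hsub hz), fun w hw => hmin hw⟩
  refine ⟨min δ 1, by positivity, min m (1 / 2), by positivity, fun z hz => ?_⟩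
  have hexp : Real.exp (-‖z‖) ≤ 1 := Real.exp_le_one_iff.2 (by simp)
  have hpos := Real.exp_pos (-‖z‖)
  by_cases hre : M ≤ |z.re|
  · have := hM z hre (hz.le.trans (min_le_right _ _))
    nlinarith [min_le_right m (1 / 2)]
  · push Not at hre
    have hmem : z ∈ Metric.cthickening δ S := by
      refine Metric.mem_cthickening_of_dist_le z (z.re : ℂ) δ S
        ⟨z.re, abs_le.1 hre.le, rfl⟩ ?_
      rw [Complex.dist_of_re_eq (by simp)]
      simpa [Real.dist_eq] using hz.le.trans (min_le_left _ _)
    have := hmin z hmem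
    nlinarith [min_le_left m (1 / 2)]

/-- For |Im z| ≤ 1 the size of q e^{-cz} is governed by Re c · Re z: it is at most 1/2 far to the
right and at least 2 far to the left. -/
theorem exists_one_sub_exp_lowerBound {c q : ℂ} (hc : 0 < c.re) (hq : q ≠ 0) :
    ∃ M : ℝ, 1 ≤ M ∧ ∀ z : ℂ, M ≤ |z.re| → |z.im| ≤ 1 →
      1 / 2 ≤ ‖1 - q * Complex.exp (-(c * z))‖ := by
  set B := ‖q‖ * Real.exp |c.im| with hB
  set b := ‖q‖ * Real.exp (-|c.im|) with hb
  have hqp : 0 < ‖q‖ := norm_pos_iff.2 hq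
  have hbp : 0 < b := by positivity
  have hBp : 0 < B := by positivity
  have ht : Filter.Tendsto (fun M : ℝ => Real.exp (c.re * M)) Filter.atTop Filter.atTop :=
    Real.tendsto_exp_atTop.comp (Filter.tendsto_id.const_mul_atTop hc)
  obtain ⟨M, hM1, hM2, hM3⟩ := ((Filter.eventually_ge_atTop (1 : ℝ)).and
    ((ht.eventually_ge_atTop (2 * B)).and (ht.eventually_ge_atTop (2 / b)))).exists
  refine ⟨M, hM1, fun z hz him => ?_⟩
  have hn : ‖q * Complex.exp (-(c * z))‖ = ‖q‖ * Real.exp (-(c.re * z.re) + c.im * z.im) := by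
    rw [norm_mul, Complex.norm_exp, Complex.neg_re, Complex.mul_re, neg_sub, sub_eq_neg_add]
  have hcz : |c.im * z.im| ≤ |c.im| := by
    rw [abs_mul]
    exact mul_le_of_le_one_right (abs_nonneg _) him
  rw [abs_le] at hcz
  rcases le_abs.1 hz with h | h
  · have h1 : ‖q * Complex.exp (-(c * z))‖ ≤ 1 / 2 := by
      rw [hn]
      calc ‖q‖ * Real.exp (-(c.re * z.re) + c.im * z.im)
          ≤ ‖q‖ * Real.exp (|c.im| - c.re * M) := by
            gcongr
            nlinarith
        _ = B / Real.exp (c.re * M) := by rw [Real.exp_sub, hB]; ring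
        _ ≤ 1 / 2 := by
          rw [div_le_div_iff₀ (Real.exp_pos _) two_pos]
          linarith
    have := norm_sub_norm_le (1 : ℂ) (q * Complex.exp (-(c * z)))
    rw [norm_one] at this
    linarith
  · have h1 : 2 ≤ ‖q * Complex.exp (-(c * z))‖ := by
      rw [hn]
      calc 2 ≤ b * Real.exp (c.re * M) := by
            rw [div_le_iff₀ hbp] at hM3
            linarith
        _ = ‖q‖ * Real.exp (c.re * M + -|c.im|) := by rw [hb, Real.exp_add]; ring
        _ ≤ _ := by
            gcongr
            · nlinarith
            · exact hcz.1
    have := norm_sub_norm_le (q * Complex.exp (-(c * z))) (1 : ℂ)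
    rw [norm_one, norm_sub_rev] at this
    linarith

theorem norm_coweightForm_le {d : ℕ} (l : Fin d → ℤ) (y : LieAlg d) :
    ‖coweightForm l y‖ ≤ ‖coweightForm l‖ * ‖y‖ := (coweightForm l).le_opNorm y

/-- Division of a tame function by a function of `⟨λ, y⟩` without real zeros. -/
theorem IsTame.div_comp_coweightForm {d : ℕ} {F : LieAlg d → ℂ} (hF : IsTame F) (l : Fin d → ℤ)
    {k : ℂ → ℂ} (hk : Differentiable ℂ k) {δ m : ℝ} (hδ : 0 < δ) (hm : 0 < m)
    (hlow : ∀ z : ℂ, |z.im| < δ → m * Real.exp (-‖z‖) ≤ ‖k z‖) :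
    ∃ eps > 0, IsTame (fun y => F y / k (coweightForm l y)) ∧
      ∀ y ∈ strip d eps, k (coweightForm l y) ≠ 0 := by
  obtain ⟨eps, C, A, heps, hC, hA, hd, hb⟩ := hF
  set L := ∑ k, |(l k : ℝ)| with hL
  have hLn : 0 ≤ L := Finset.sum_nonneg fun _ _ => abs_nonneg _
  -- On the tube of width e one has |Im⟨λ,y⟩| ≤ L e < δ.
  set e := min eps (δ / (L + 1)) with he
  have hep : 0 < e := by positivity
  have him : ∀ y ∈ strip d e, |(coweightForm l y).im| < δ := by
    intro y hy
    have := abs_im_coweightForm_le l hy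
    have h2 : (L + 1) * e ≤ δ := by
      rw [mul_comm, ← le_div_iff₀ (by positivity)]
      exact min_le_right _ _
    nlinarith
  have hpos : ∀ y ∈ strip d e, 0 < ‖k (coweightForm l y)‖ := fun y hy =>
    lt_of_lt_of_le (by positivity) (hlow _ (him y hy))
  refine ⟨e, hep, ⟨e, C / m, A + ‖coweightForm l‖, hep, by positivity, by positivity, ?_, ?_⟩,
    fun y hy => norm_pos_iff.1 (hpos y hy)⟩
  · simp only [div_eq_mul_inv]
    refine (hd.mono (strip_mono (min_le_left _ _))).mul (DifferentiableOn.inv ?_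
      fun y hy => norm_pos_iff.1 (hpos y hy))
    exact (hk.comp (coweightForm l).differentiable).differentiableOn
  · intro y hy
    rw [norm_div, div_le_iff₀ (hpos y hy)]
    have h1 := hb y (strip_mono (min_le_left _ _) hy)
    have h2 := hlow _ (him y hy)
    have h3 := norm_coweightForm_le l y
    calc ‖F y‖ ≤ C * Real.exp (A * ‖y‖) := h1
      _ ≤ C * Real.exp ((A + ‖coweightForm l‖) * ‖y‖ + -‖coweightForm l y‖) := by
        gcongr
        linarith
      _ = C / m * Real.exp ((A + ‖coweightForm l‖) * ‖y‖) *
          (m * Real.exp (-‖coweightForm l y‖)) := by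
        rw [Real.exp_add]
        field_simp
      _ ≤ _ := by gcongr

/-- Division of a tame function by a linear form on whose kernel it vanishes. -/
theorem IsTame.exists_div_coweightForm {d : ℕ} {F : LieAlg d → ℂ} (hF : IsTame F) {l : Fin d → ℤ}
    (hl : l ≠ 0) {e₀ : ℝ} (he₀ : 0 < e₀)
    (hz : ∀ y ∈ strip d e₀, coweightForm l y = 0 → F y = 0) :
    ∃ G : LieAlg d → ℂ, IsTame G ∧ ∃ eps > 0, ∀ y ∈ strip d eps, coweightForm l y * G y = F y := by
  obtain ⟨eps', C, A, heps', hC, hA, hd', hb'⟩ := hF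
  obtain ⟨eps, heps, hee, hee₀⟩ : ∃ eps > 0, eps ≤ eps' ∧ eps ≤ e₀ :=
    ⟨min eps' e₀, by positivity, min_le_left _ _, min_le_right _ _⟩
  have hd := hd'.mono (strip_mono hee)
  have hb := fun y hy => hb' y (strip_mono hee hy)
  obtain ⟨k, hk⟩ : ∃ k, l k ≠ 0 := by
    by_contra! h
    exact hl (funext h)
  -- A real vector with ⟨λ,v⟩ = 1 and entries of size at most 1. The quotient will be G(y) = ∫₀¹
  -- (∂_v F)(y + (t-1)⟨λ,y⟩v) dt.
  set v : LieAlg d := EuclideanSpace.single k ((l k : ℂ)⁻¹) with hv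
  have hlv : coweightForm l v = 1 := by
    simp [coweightForm_apply, v, hk]
  have hlk : (1 : ℝ) ≤ |(l k : ℝ)| := by
    have : 1 ≤ |l k| := Int.one_le_abs hk
    exact_mod_cast this
  have hvn : ‖v‖ ≤ 1 := by
    rw [hv, PiLp.norm_single, norm_inv, Complex.norm_intCast]
    exact inv_le_one_of_one_le₀ hlk
  have hvim : ∀ (t : ℂ) (j : Fin d), |((t • v) j).im| ≤ |t.im| := by
    intro t j
    have hvj : v j = if j = k then (((l k : ℝ)⁻¹ : ℝ) : ℂ) else 0 := by
      simp [v]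
    rw [PiLp.smul_apply, hvj]
    split_ifs
    · rw [smul_eq_mul, Complex.im_mul_ofReal, abs_mul, abs_inv]
      exact mul_le_of_le_one_right (abs_nonneg _) (inv_le_one_of_one_le₀ hlk)
    · simp
  have hshift : ∀ {e₁ e₂ : ℝ} {z : LieAlg d} (t : ℂ), z ∈ strip d e₁ → |t.im| ≤ e₂ →
      z + t • v ∈ strip d (e₁ + e₂) := by
    intro e₁ e₂ z t hz ht j
    rw [PiLp.add_apply, Complex.add_im]
    exact (abs_add_le _ _).trans_lt (add_lt_add_of_lt_of_le (hz j) ((hvim t j).trans ht))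
  set D : LieAlg d → ℂ := fun z => iteratedDeriv 1 (fun t : ℂ => F (z + t • v)) 0 with hD
  have hDd : DifferentiableOn ℂ D (strip d eps) :=
    (differentiableOn_iteratedDeriv_line (isOpen_strip d eps) hd 1).comp
      (f := fun z => (z, v)) (by fun_prop) fun z hz => ⟨hz, trivial⟩
  have hDb : ∀ z ∈ strip d (eps / 2), ‖D z‖ ≤
      C * Real.exp (A * (eps / 4)) / (eps / 4) * Real.exp (A * ‖z‖) := by
    intro z hz
    have hmem : ∀ t : ℂ, ‖t‖ ≤ eps / 4 → z + t • v ∈ strip d eps := by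
      intro t ht
      refine strip_mono ?_ (hshift t hz ((Complex.abs_im_le_norm t).trans ht))
      linarith
    have hdl : DifferentiableOn ℂ (fun t : ℂ => F (z + t • v)) (Metric.closedBall 0 (eps / 4)) :=
      hd.comp (by fun_prop) fun t ht => hmem t (by simpa using ht)
    have := Complex.norm_iteratedDeriv_le_of_forall_mem_sphere_norm_le 1
      (C := C * Real.exp (A * (eps / 4)) * Real.exp (A * ‖z‖))
      (by positivity : 0 < eps / 4) (hdl.diffContOnCl_ball Set.Subset.rfl) (by
        intro t ht
        have ht' : ‖t‖ = eps / 4 := by simpa using ht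
        refine (hb _ (hmem t ht'.le)).trans ?_
        rw [mul_assoc, ← Real.exp_add, ← mul_add]
        gcongr
        refine (norm_add_le _ _).trans ?_
        rw [norm_smul, ht', add_comm]
        gcongr
        exact mul_le_of_le_one_right (by positivity) hvn)
    refine this.trans (le_of_eq ?_)
    simp
    ring
  set L := ∑ k, |(l k : ℝ)| with hL
  have hLn : 0 ≤ L := Finset.sum_nonneg fun _ _ => abs_nonneg _
  -- Moving y in direction v by at most |⟨λ,y⟩| enlarges the imaginary parts by at most L e, and e +
  -- L e = eps/2, where the Cauchy bound for D is available.
  set e := eps / (2 * (1 + L)) with he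
  have hep : 0 < e := by positivity
  have heL : e + L * e = eps / 2 := by rw [he]; field_simp
  -- The segment from the projection of y to the kernel of λ, at t = 0, to y, at t = 1.
  set u : LieAlg d → ℝ → LieAlg d := fun y t => y + (((t - 1 : ℝ) : ℂ) * coweightForm l y) • v
    with hu
  have hus : ∀ y ∈ strip d e, ∀ t ∈ Set.Icc (0 : ℝ) 1, u y t ∈ strip d (eps / 2) := by
    intro y hy t ht
    rw [← heL]
    refine hshift _ hy ?_
    rw [Complex.im_ofReal_mul, abs_mul]
    refine le_trans ?_ (abs_im_coweightForm_le l hy)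
    refine mul_le_of_le_one_left (abs_nonneg _) ?_
    rw [abs_le]
    constructor <;> linarith [ht.1, ht.2]
  have hun : ∀ y, ∀ t ∈ Set.Icc (0 : ℝ) 1, ‖u y t‖ ≤ (1 + ‖coweightForm l‖) * ‖y‖ := by
    intro y t ht
    have h1 : |t - 1| ≤ 1 := by
      rw [abs_le]
      constructor <;> linarith [ht.1, ht.2]
    calc ‖u y t‖ ≤ ‖y‖ + ‖(((t - 1 : ℝ) : ℂ) * coweightForm l y) • v‖ := norm_add_le _ _
      _ = ‖y‖ + |t - 1| * ‖coweightForm l y‖ * ‖v‖ := by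
        rw [norm_smul, norm_mul, Complex.norm_real, Real.norm_eq_abs]
      _ ≤ ‖y‖ + 1 * (‖coweightForm l‖ * ‖y‖) * 1 := by
        gcongr
        exact norm_coweightForm_le l y
      _ = _ := by ring
  have huc : ∀ y, Continuous (u y) := fun y => by fun_prop
  -- Clamping t to [0,1] gives holomorphy and bounds for every t, as the parametric lemma requires,
  -- and does not change the integral.
  set κ : ℝ → ℝ := fun t => max 0 (min 1 t) with hκ
  have hκm : ∀ t, κ t ∈ Set.Icc (0 : ℝ) 1 := fun t =>
    ⟨le_max_left _ _, max_le zero_le_one (min_le_left _ _)⟩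
  have hκc : Continuous κ := by fun_prop
  set K := C * Real.exp (A * (eps / 4)) / (eps / 4) with hK
  have hKn : 0 ≤ K := by positivity
  have hint : ∀ y ∈ strip d e, ∀ t,
      ‖D (u y (κ t))‖ ≤ K * Real.exp (A * (1 + ‖coweightForm l‖) * ‖y‖) := by
    intro y hy t
    refine (hDb _ (hus y hy _ (hκm t))).trans ?_
    rw [mul_assoc A]
    gcongr
    exact hun y _ (hκm t)
  have hhalf : strip d (eps / 2) ⊆ strip d eps := strip_mono (by linarith)
  refine ⟨fun y => ∫ t in Set.Ioc (0 : ℝ) 1, D (u y (κ t)), ?_, e, hep, ?_⟩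
  · refine ⟨e, K, A * (1 + ‖coweightForm l‖), hep, hKn, by positivity, ?_, ?_⟩
    · intro y₀ hy₀
      -- The exponential bound is uniform only on bounded sets, so differentiability is proved
      -- locally.
      set O := strip d e ∩ Metric.ball 0 (‖y₀‖ + 1) with hO
      have hOo : IsOpen O := (isOpen_strip d e).inter Metric.isOpen_ball
      have hy₀O : y₀ ∈ O := ⟨hy₀, by simp⟩
      refine ((differentiableOn_integral_of_dominated hOo
        (g := fun _ => K * Real.exp (A * (1 + ‖coweightForm l‖) * (‖y₀‖ + 1)))
        ?_ ?_ ?_ ?_).differentiableAt (hOo.mem_nhds hy₀O)).differentiableWithinAt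
      · intro t
        exact hDd.comp (by fun_prop) fun y hy => hhalf (hus y hy.1 _ (hκm t))
      · intro y hy
        exact (hDd.continuousOn.comp_continuous ((huc y).comp hκc)
          fun t => hhalf (hus y hy.1 _ (hκm t))).aestronglyMeasurable
      · exact integrable_const _
      · intro y hy t
        refine (hint y hy.1 t).trans ?_
        gcongr
        exact (mem_ball_zero_iff.1 hy.2).le
    · intro y hy
      refine (norm_setIntegral_le_of_norm_le_const (by simp) fun t _ => hint y hy t).trans ?_
      simp
  · intro y hy
    have hcongr : ∫ t in Set.Ioc (0 : ℝ) 1, D (u y (κ t)) = ∫ t in (0 : ℝ)..1, D (u y t) := by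
      rw [intervalIntegral.integral_of_le zero_le_one]
      refine setIntegral_congr_fun measurableSet_Ioc fun t ht => ?_
      simp only [hκ, min_eq_right ht.2, max_eq_right ht.1.le]
    have hderiv : ∀ t ∈ Set.uIcc (0 : ℝ) 1,
        HasDerivAt (fun t => F (u y t)) (coweightForm l y * D (u y t)) t := by
      intro t ht
      rw [Set.uIcc_of_le zero_le_one] at ht
      have hmem := hhalf (hus y hy t ht)
      have h1 : HasDerivAt (fun s : ℂ => F (u y t + s • v)) (D (u y t)) 0 := by
        rw [hD]
        simp only [iteratedDeriv_one]
        refine DifferentiableAt.hasDerivAt ?_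
        refine DifferentiableAt.comp (0 : ℂ) (g := F) ?_ (by fun_prop)
        simpa using hd.differentiableAt ((isOpen_strip d eps).mem_nhds hmem)
      have h2 : HasDerivAt (fun t' : ℝ => ((t' - t : ℝ) : ℂ) * coweightForm l y)
          (coweightForm l y) t := by
        have := (((hasDerivAt_id t).sub_const t).ofReal_comp).mul_const (coweightForm l y)
        simpa using this
      have h3 := HasDerivAt.comp t (h₂ := fun s : ℂ => F (u y t + s • v))
        (h := fun t' : ℝ => ((t' - t : ℝ) : ℂ) * coweightForm l y) (by simpa using h1) h2
      rw [mul_comm]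
      refine h3.congr_of_eventuallyEq (Filter.Eventually.of_forall fun t' => ?_)
      simp only [Function.comp_apply, hu, add_assoc, ← add_smul, ← add_mul]
      congr 4
      push_cast
      ring
    have hcont : ContinuousOn (fun t => coweightForm l y * D (u y t)) (Set.uIcc 0 1) := by
      rw [Set.uIcc_of_le zero_le_one]
      refine continuousOn_const.mul (hDd.continuousOn.comp (huc y).continuousOn
        fun t ht => hhalf (hus y hy t ht))
    have hftc := intervalIntegral.integral_eq_sub_of_hasDerivAt hderiv hcont.intervalIntegrable
    rw [intervalIntegral.integral_const_mul] at hftc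
    beta_reduce
    rw [hcongr, hftc]
    have hu0 : F (u y 0) = 0 := by
      refine hz _ (strip_mono (by linarith) (hus y hy 0 (by simp))) ?_
      simp [hu, hlv]
    rw [hu0, sub_zero]
    simp [hu]

/-- `T` has a generating function that is holomorphic and of exponential growth on a tube around
`ℝ^d`. -/
def HasTameGenerating {d : ℕ} (c : ℂ) (T : MvPolynomial (Fin d) ℂ →ₗ[ℂ] ℂ) : Prop :=
  ∃ F, IsTame F ∧ IsGenerating c T F

theorem IsTame.exists_differentiableOn {d : ℕ} {F : LieAlg d → ℂ} (hF : IsTame F) {e : ℝ}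
    (he : 0 < e) : ∃ eps > 0, eps ≤ e ∧ DifferentiableOn ℂ F (strip d eps) := by
  obtain ⟨eps, C, A, heps, -, -, hd, -⟩ := hF
  exact ⟨min eps e, by positivity, min_le_right _ _, hd.mono (strip_mono (min_le_left _ _))⟩

/-- If `T ∘ (1 - q S_{-λ})` has a tame generating function, then so has `T`, provided that
`1 - q e^{-cx}` has no real zero except possibly `0`. -/
theorem HasTameGenerating.of_comp_quasiDifference {d : ℕ} {c q : ℂ} (hc : 0 < c.re) (hq : q ≠ 0)
    {l : Fin d → ℤ} (hl : l ≠ 0) (hreal : ∀ x : ℝ, Complex.exp (c * x) = q → x = 0)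
    {T : MvPolynomial (Fin d) ℂ →ₗ[ℂ] ℂ} (h : HasTameGenerating c (T ∘ₗ quasiDifference q l)) :
    HasTameGenerating c T := by
  have hc0 : c ≠ 0 := by
    rintro rfl
    simp at hc
  obtain ⟨F, hF, hgen⟩ := h
  set h : ℂ → ℂ := fun z => 1 - q * Complex.exp (-(c * z)) with hh
  have hhd : Differentiable ℂ h := by fun_prop
  obtain ⟨M, hM1, hM⟩ := exists_one_sub_exp_lowerBound hc hq
  have hzero : ∀ x : ℝ, h x = 0 → x = 0 := by
    intro x hx
    refine hreal x ?_
    have : q * Complex.exp (-(c * x)) = 1 := (sub_eq_zero.1 hx).symm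
    rw [Complex.exp_neg, mul_inv_eq_one₀ (Complex.exp_ne_zero _)] at this
    exact this.symm
  by_cases hq1 : q = 1
  · subst hq1
    -- For q = 1 write 1 - e^{-cz} = z k(z). Then k(0) = c ≠ 0, so k has no real zero; F is divided
    -- first by ⟨λ,y⟩, on whose kernel it vanishes, and then by k(⟨λ,y⟩).
    set k := dslope h 0 with hk
    have h00 : h 0 = 0 := by simp [hh]
    have hkd : Differentiable ℂ k := by
      rw [← differentiableOn_univ] at hhd ⊢
      exact (Complex.differentiableOn_dslope Filter.univ_mem).2 hhd
    have hkmul : ∀ z, z * k z = h z := by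
      intro z
      have := sub_smul_dslope h 0 z
      simpa [h00] using this
    have hk0 : ∀ x : ℝ, k x ≠ 0 := by
      intro x hx
      have hx0 : x = 0 := hzero x (by rw [← hkmul, hx, mul_zero])
      subst hx0
      have hder : HasDerivAt h c 0 := by
        have := ((((hasDerivAt_id (0 : ℂ)).const_mul c).neg.cexp).const_mul 1).const_sub 1
        simpa [hh] using this
      rw [Complex.ofReal_zero, hk, dslope_same, hder.deriv] at hx
      exact hc0 hx
    obtain ⟨δ, hδ, m, hm, hlow⟩ := exists_im_lt_lowerBound hkd.continuous hk0 (M := M) (by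
      intro z hz him
      have h1 := hM z hz him
      have hzn : 1 ≤ ‖z‖ := hM1.trans (hz.trans (Complex.abs_re_le_norm z))
      have h2 : ‖z‖ * ‖k z‖ = ‖h z‖ := by rw [← norm_mul, hkmul]
      have h3 : ‖z‖ * Real.exp (-‖z‖) ≤ 1 := by
        rw [Real.exp_neg, mul_inv_le_iff₀ (Real.exp_pos _), one_mul]
        linarith [Real.add_one_le_exp ‖z‖]
      refine le_of_mul_le_mul_left ?_ (by linarith : 0 < ‖z‖)
      rw [h2]
      refine le_trans ?_ h1
      linarith)
    obtain ⟨e₀, he₀, -, hd₀⟩ := hF.exists_differentiableOn one_pos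
    obtain ⟨G, hG, e₁, he₁, hmul₁⟩ := hF.exists_div_coweightForm hl he₀ fun y hy hly =>
      hgen.eq_zero_of_coweightForm_eq_zero he₀ hd₀ hy hly
    obtain ⟨e₂, he₂, htame, hne⟩ := hG.div_comp_coweightForm l hkd hδ hm hlow
    refine ⟨_, htame, ?_⟩
    obtain ⟨e, he, hle, hd⟩ := htame.exists_differentiableOn (lt_min he₁ he₂)
    refine IsGenerating.of_mul hc0 hl he hd (fun y hy => ?_) hgen
    have hne' := hne y (strip_mono (hle.trans (min_le_right _ _)) hy)
    rw [← hmul₁ y (strip_mono (hle.trans (min_le_left _ _)) hy)]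
    change h (coweightForm l y) * _ = _
    rw [← hkmul]
    field_simp
  · have hk0 : ∀ x : ℝ, h x ≠ 0 := by
      intro x hx
      have hx0 := hzero x hx
      subst hx0
      simp only [hh, Complex.ofReal_zero, mul_zero, neg_zero, Complex.exp_zero, mul_one] at hx
      exact hq1 (sub_eq_zero.1 hx).symm
    obtain ⟨δ, hδ, m, hm, hlow⟩ := exists_im_lt_lowerBound hhd.continuous hk0 (M := M) (by
      intro z hz him
      have h1 := hM z hz him
      have : Real.exp (-‖z‖) ≤ 1 := Real.exp_le_one_iff.2 (by simp)
      linarith)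
    obtain ⟨e₁, he₁, htame, hne⟩ := hF.div_comp_coweightForm l hhd hδ hm hlow
    refine ⟨_, htame, ?_⟩
    obtain ⟨e, he, hle, hd⟩ := htame.exists_differentiableOn he₁
    refine IsGenerating.of_mul hc0 hl he hd (fun y hy => ?_) hgen
    exact mul_div_cancel₀ _ (hne y (strip_mono hle hy))

/-! ### The trace identity as a family of annihilating ideals -/

theorem shift_shift {d : ℕ} (l m : Fin d → ℤ) (f : MvPolynomial (Fin d) ℂ) :
    shift l (shift m f) = shift (l + m) f := by
  have : (shift l).comp (shift m) = shift (d := d) (l + m) := by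
    refine MvPolynomial.algHom_ext fun k => ?_
    simp [shift]
    ring
  exact DFunLike.congr_fun this f

theorem shift_zero {d : ℕ} (f : MvPolynomial (Fin d) ℂ) : shift 0 f = f := by
  have : shift (d := d) 0 = AlgHom.id ℂ _ := MvPolynomial.algHom_ext fun k => by simp [shift]
  rw [this, AlgHom.id_apply]

theorem shift_linearForm_add_C {d : ℕ} (x l : Fin d → ℤ) (a : ℂ) :
    shift l (linearForm x + MvPolynomial.C a) =
      linearForm x + MvPolynomial.C (a + (pairing x l : ℂ)) := by
  simp only [shift, linearForm, pairing, map_add, map_sum, map_mul, MvPolynomial.aeval_X,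
    MvPolynomial.algHom_C, MvPolynomial.algebraMap_eq, mul_add, Finset.sum_add_distrib,
    Int.cast_sum, Int.cast_mul]
  ring

theorem pairing_neg {d : ℕ} (x l : Fin d → ℤ) : pairing x (-l) = -pairing x l := by
  simp [pairing]

/-- The multiplicative set generated by the polynomials `ξ_i + a` with `ξ_i(λ) ≠ 0`. -/
noncomputable def transverseForms {d n : ℕ} (xi : Fin n → Fin d → ℤ) (l : Fin d → ℤ) :
    Submonoid (MvPolynomial (Fin d) ℂ) :=
  Submonoid.closure {p | ∃ i a, pairing (xi i) l ≠ 0 ∧ p = linearForm (xi i) + MvPolynomial.C a}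

/-- `T` kills the ideal of some product of polynomials `ξ_i + a` with `ξ_i(λ) ≠ 0`. -/
def IsTransverse {d n : ℕ} (xi : Fin n → Fin d → ℤ) (T : MvPolynomial (Fin d) ℂ →ₗ[ℂ] ℂ)
    (l : Fin d → ℤ) : Prop :=
  ∃ R ∈ transverseForms xi l, ∀ f, T (R * f) = 0

theorem shift_mem_transverseForms {d n : ℕ} {xi : Fin n → Fin d → ℤ} {l : Fin d → ℤ}
    (m : Fin d → ℤ) {R : MvPolynomial (Fin d) ℂ} (hR : R ∈ transverseForms xi l) :
    shift m R ∈ transverseForms xi l := by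
  have : transverseForms xi l ≤ (transverseForms xi l).comap (shift m) := by
    rw [transverseForms, Submonoid.closure_le]
    rintro p ⟨i, a, hi, rfl⟩
    exact Submonoid.subset_closure ⟨i, _, hi, shift_linearForm_add_C _ _ _⟩
  exact this hR

/-- If R annihilates T, then R · S_m R annihilates T ∘ (1 - q S_{-m}): the factor R handles the
identity, and S_{-m} turns the factor S_m R back into R. -/
theorem IsTransverse.comp_quasiDifference {d n : ℕ} {xi : Fin n → Fin d → ℤ}
    {T : MvPolynomial (Fin d) ℂ →ₗ[ℂ] ℂ} {l : Fin d → ℤ} (h : IsTransverse xi T l) (q : ℂ)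
    (m : Fin d → ℤ) : IsTransverse xi (T ∘ₗ quasiDifference q m) l := by
  obtain ⟨R, hR, hT⟩ := h
  refine ⟨R * shift m R, mul_mem hR (shift_mem_transverseForms m hR), fun f => ?_⟩
  have h1 : T (shift (-m) (R * shift m R * f)) = 0 := by
    have : shift (-m) (R * shift m R * f) = R * (shift (-m) R * shift (-m) f) := by
      rw [map_mul, map_mul, shift_shift, neg_add_cancel, shift_zero]
      ring
    rw [this, hT]
  have h2 : T (R * shift m R * f) = 0 := by rw [mul_assoc, hT]
  simp only [quasiDifference, LinearMap.comp_apply, LinearMap.sub_apply, LinearMap.id_apply,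
    LinearMap.smul_apply, AlgHom.toLinearMap_apply, map_sub, map_smul, h1, h2, smul_zero, sub_zero]

theorem quasiDifference_comm {d : ℕ} (q r : ℂ) (l m : Fin d → ℤ) :
    quasiDifference q l ∘ₗ quasiDifference r m = quasiDifference r m ∘ₗ quasiDifference q l := by
  refine LinearMap.ext fun f => ?_
  simp only [quasiDifference, LinearMap.comp_apply, LinearMap.sub_apply, LinearMap.id_apply,
    LinearMap.smul_apply, AlgHom.toLinearMap_apply, map_sub, map_smul, shift_shift, add_comm (-l)]
  module

theorem structureFactor_mem_transverseForms {d n : ℕ} (xi : Fin n → Fin d → ℤ) (b : Fin n → ℂ)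
    (l : Fin d → ℤ) (i : Fin n) :
    structureFactor (xi i) (b i) l (-l) ∈ transverseForms xi l := by
  simp only [structureFactor]
  split_ifs with h1 h2
  · exact prod_mem fun j _ => Submonoid.subset_closure ⟨i, _, h1.1.ne', rfl⟩
  · exact prod_mem fun j _ => Submonoid.subset_closure ⟨i, _, h2.1.ne, rfl⟩
  · exact one_mem _

/-- The shift matches the two products up to reversing the order of the factors, j ↦ N + 1 - j. It
relates r^λ r^{-λ} to r^{-λ} r^λ. -/
theorem shift_structureFactor {d : ℕ} (x : Fin d → ℤ) (b : ℂ) (l : Fin d → ℤ) :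
    shift (-l) (structureFactor x b l (-l)) = structureFactor x b (-l) l := by
  have hrefl : ∀ (N : ℕ) (f g : ℕ → MvPolynomial (Fin d) ℂ),
      (∀ j ∈ Finset.Icc 1 N, f j = g (N + 1 - j)) →
      ∏ j ∈ Finset.Icc 1 N, f j = ∏ j ∈ Finset.Icc 1 N, g j := by
    intro N f g h
    refine Finset.prod_nbij' (fun j => N + 1 - j) (fun j => N + 1 - j) ?_ ?_ ?_ ?_ h <;>
      · intro j hj
        simp only [Finset.mem_Icc] at *
        omega
  simp only [structureFactor, pairing_neg, Int.natAbs_neg, min_self]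
  rcases lt_trichotomy (pairing x l) 0 with hp | hp | hp
  · rw [if_neg (by omega), if_pos (by omega), if_pos (by omega), map_prod]
    refine hrefl _ _ _ fun j hj => ?_
    have hj := Finset.mem_Icc.1 hj
    rw [shift_linearForm_add_C, pairing_neg]
    congr 2
    have : ((pairing x l : ℤ) : ℂ) = -((pairing x l).natAbs : ℂ) := by
      rw [← Int.cast_natCast, ← Int.cast_neg]
      congr 1
      omega
    rw [Nat.cast_sub (by omega)]
    push_cast [this]
    ring
  · simp [hp]
  · rw [if_pos (by omega), if_neg (by omega), if_pos (by omega), map_prod]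
    refine hrefl _ _ _ fun j hj => ?_
    have hj := Finset.mem_Icc.1 hj
    rw [shift_linearForm_add_C, pairing_neg]
    congr 2
    have : ((pairing x l : ℤ) : ℂ) = ((pairing x l).natAbs : ℂ) := by
      rw [← Int.cast_natCast]
      congr 1
      omega
    rw [Nat.cast_sub (by omega)]
    push_cast [this]
    ring

theorem mul_single_single {d n : ℕ} (xi : Fin n → Fin d → ℤ) (b : Fin n → ℂ) (l m : Fin d → ℤ)
    (f h : MvPolynomial (Fin d) ℂ) :
    mul xi b (Finsupp.single l f) (Finsupp.single m h) =
      Finsupp.single (l + m) (f * shift l h * ∏ i, structureFactor (xi i) (b i) l m) := by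
  rw [mul, Finsupp.sum_single_index, Finsupp.sum_single_index] <;> simp

/-- The restriction of a linear map on the Coulomb branch to `ℂ[𝔱]`. -/
noncomputable def restrictCartan {d : ℕ} (T : Branch d →ₗ[ℂ] ℂ) :
    MvPolynomial (Fin d) ℂ →ₗ[ℂ] ℂ :=
  T ∘ₗ Finsupp.lsingle 0

theorem restrictCartan_apply {d : ℕ} (T : Branch d →ₗ[ℂ] ℂ) (f : MvPolynomial (Fin d) ℂ) :
    restrictCartan T f = T (Finsupp.single 0 f) := rfl

/-- Put A = ∏_i A_i(λ,-λ). The trace property for f r^λ and r^{-λ} reads T(fA) = q T(S_{-λ}(f)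
S_{-λ}(A)), so the ideal (A) is killed; each factor of A involves a weight with ξ_i(λ) ≠ 0. -/
theorem IsTwistedTrace.isTransverse {d n : ℕ} {xi : Fin n → Fin d → ℤ} {b : Fin n → ℂ}
    {zeta : Fin d → ℂ} {T : Branch d →ₗ[ℂ] ℂ} (hT : IsTwistedTrace xi b zeta T)
    (l : Fin d → ℤ) :
    IsTransverse xi (restrictCartan T ∘ₗ quasiDifference (twistFactor zeta l) l) l := by
  refine ⟨∏ i, structureFactor (xi i) (b i) l (-l),
    prod_mem fun i _ => structureFactor_mem_transverseForms xi b l i, fun f => ?_⟩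
  have h := hT (Finsupp.single l f) (Finsupp.single (-l) 1)
  rw [twist, Finsupp.sum_single_index (by simp), mul_single_single, mul_single_single,
    add_neg_cancel, neg_add_cancel, ← restrictCartan_apply, ← restrictCartan_apply] at h
  simp only [map_one, mul_one, one_mul, map_smul, smul_mul_assoc] at h
  simp only [quasiDifference, LinearMap.comp_apply, LinearMap.sub_apply, LinearMap.id_apply,
    LinearMap.smul_apply, AlgHom.toLinearMap_apply, map_sub, map_smul, map_mul, map_prod,
    shift_structureFactor]
  rw [mul_comm, h, mul_comm (shift (-l) f), sub_self]

/-! ### One-dimensional flats of the weight arrangement -/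

/-- If integral vectors have no common zero in `ℤ^d`, they have none in `M^d` for any complex
vector space `M`. -/
theorem eq_zero_of_forall_pairing {d : ℕ} {W : Set (Fin d → ℤ)}
    (hW : ∀ l : Fin d → ℤ, (∀ w ∈ W, pairing w l = 0) → l = 0) {M : Type*} [AddCommGroup M]
    [Module ℂ M] {m : Fin d → M} (hm : ∀ w ∈ W, ∑ k, (w k : ℂ) • m k = 0) : m = 0 := by
  let : Module ℚ M := Module.compHom M (algebraMap ℚ ℂ)
  -- Clearing denominators passes from ℤ to ℚ; testing with ℚ-linear functionals then passes to M.
  have hQ : ∀ v : Fin d → ℚ, (∀ w ∈ W, ∑ k, (w k : ℚ) * v k = 0) → v = 0 := by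
    intro v hv
    obtain ⟨b, hb⟩ := IsLocalization.exist_integer_multiples_of_finite (nonZeroDivisors ℤ) v
    choose l hl using hb
    have hl' : ∀ k, (l k : ℚ) = (b : ℤ) * v k := by
      intro k
      have := hl k
      rw [zsmul_eq_mul] at this
      exact this
    have hl0 : l = 0 := by
      refine hW l fun w hw => ?_
      have : ((pairing w l : ℤ) : ℚ) = (b : ℤ) * ∑ k, (w k : ℚ) * v k := by
        simp only [pairing, Int.cast_sum, Int.cast_mul, hl', Finset.mul_sum]
        exact Finset.sum_congr rfl fun k _ => by ring
      rw [hv w hw, mul_zero] at this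
      exact_mod_cast this
    funext k
    have hk := hl' k
    have hb0 : ((b : ℤ) : ℚ) ≠ 0 := by exact_mod_cast nonZeroDivisors.coe_ne_zero b
    rw [hl0] at hk
    simpa [hb0] using hk.symm
  funext k
  rw [Pi.zero_apply, ← Module.forall_dual_apply_eq_zero_iff ℚ]
  intro φ
  refine congrFun (hQ (fun j => φ (m j)) fun w hw => ?_) k
  have := congrArg φ (hm w hw)
  simpa only [Int.cast_smul_eq_zsmul, map_sum, map_zsmul, zsmul_eq_mul, map_zero] using this

theorem pairing_smul_right {d : ℕ} (x l : Fin d → ℤ) (a : ℤ) :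
    pairing x (a • l) = a * pairing x l := by
  simp only [pairing, Pi.smul_apply, smul_eq_mul, Finset.mul_sum]
  exact Finset.sum_congr rfl fun k _ => by ring

theorem pairing_sub_right {d : ℕ} (x l m : Fin d → ℤ) :
    pairing x (l - m) = pairing x l - pairing x m := by
  simp [pairing, mul_sub]

theorem exists_primitive {d : ℕ} {l : Fin d → ℤ} (hl : l ≠ 0) :
    ∃ (a : ℤ) (m : Fin d → ℤ), a ≠ 0 ∧ l = a • m ∧
      ∀ (c : ℤ) (v : Fin d → ℤ), m = c • v → IsUnit c := by
  obtain ⟨k, hk⟩ : ∃ k, l k ≠ 0 := by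
    by_contra! h
    exact hl (funext h)
  obtain ⟨m, hm, hg⟩ := Finset.extract_gcd l (s := Finset.univ) ⟨k, Finset.mem_univ k⟩
  refine ⟨Finset.univ.gcd l, m, ?_, funext fun j => hm j (Finset.mem_univ j), ?_⟩
  · intro h
    exact hk (Finset.gcd_eq_zero_iff.1 h k (Finset.mem_univ k))
  · rintro c v rfl
    refine isUnit_of_dvd_one ?_
    rw [← hg]
    exact Finset.dvd_gcd fun j _ => ⟨v j, rfl⟩

/-- If the weights span, then weights that do not span vanish on a primitive vector whose line is
an intersection of weight hyperplanes. -/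
theorem exists_spansFlat {d n : ℕ} {xi : Fin n → Fin d → ℤ}
    (hspan : ∀ l : Fin d → ℤ, (∀ i, pairing (xi i) l = 0) → l = 0) {S : Finset (Fin n)}
    {l₀ : Fin d → ℤ} (hl₀ : l₀ ≠ 0) (hS : ∀ i ∈ S, pairing (xi i) l₀ = 0) :
    ∃ l, SpansFlat xi l ∧ ∀ i ∈ S, pairing (xi i) l = 0 := by
  set P : Finset (Fin n) → Prop := fun J => ∃ l : Fin d → ℤ, l ≠ 0 ∧ ∀ i ∈ J, pairing (xi i) l = 0
    with hP
  -- A maximal set of weights with a nonzero common zero: its common zero space is a line.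
  obtain ⟨J, hSJ, hJ⟩ := Finite.exists_le_maximal (p := P) ⟨l₀, hl₀, hS⟩
  obtain ⟨l₁, hl₁, hJl₁⟩ := hJ.prop
  obtain ⟨a, l, ha, rfl, hprim⟩ := exists_primitive hl₁
  have hl : l ≠ 0 := by
    rintro rfl
    simp at hl₁
  have hJl : ∀ i ∈ J, pairing (xi i) l = 0 := by
    intro i hi
    have := hJl₁ i hi
    rw [pairing_smul_right] at this
    exact (mul_eq_zero.1 this).resolve_left ha
  refine ⟨l, ⟨hl, hprim, fun v hv => ?_⟩, fun i hi => hJl i (hSJ hi)⟩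
  obtain ⟨k₀, hk₀⟩ : ∃ k, l k ≠ 0 := by
    by_contra! h
    exact hl (funext h)
  obtain ⟨j₀, hj₀⟩ : ∃ j, pairing (xi j) l ≠ 0 := by
    by_contra! h
    exact hl (hspan l h)
  have hj₀J : j₀ ∉ J := fun h => hj₀ (hJl _ h)
  -- A common zero of J with vanishing k₀-th coordinate is 0: otherwise eliminating ξ_{j₀} between m
  -- and l would give a nonzero common zero of J ∪ {j₀}, or make m itself a multiple of l.
  have hW : ∀ m : Fin d → ℤ, (∀ w ∈ insert (Pi.single k₀ 1) {w | ∃ i ∈ J, w = xi i},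
      pairing w m = 0) → m = 0 := by
    intro m hm
    have hmk : m k₀ = 0 := by
      have := hm _ (Set.mem_insert _ _)
      simpa [pairing, Pi.single_apply] using this
    have hmJ : ∀ i ∈ J, pairing (xi i) m = 0 := fun i hi =>
      hm _ (Set.mem_insert_of_mem _ ⟨i, hi, rfl⟩)
    set m' := pairing (xi j₀) l • m - pairing (xi j₀) m • l with hm'
    have hm'0 : m' = 0 := by
      by_contra hne
      have : P (insert j₀ J) := by
        refine ⟨m', hne, fun i hi => ?_⟩
        rw [hm', pairing_sub_right, pairing_smul_right, pairing_smul_right]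
        rcases Finset.mem_insert.1 hi with rfl | hi
        · ring
        · rw [hmJ i hi, hJl i hi]
          ring
      exact hj₀J (hJ.le_of_ge this (Finset.subset_insert _ _) (Finset.mem_insert_self _ _))
    have h0 : pairing (xi j₀) m = 0 := by
      have := congrFun hm'0 k₀
      simpa [hm', hmk, hk₀] using this
    rw [hm', h0, zero_smul, sub_zero] at hm'0
    exact (smul_eq_zero.1 hm'0).resolve_left hj₀
  -- The combination l_{k₀} v - v_{k₀} l lies in the flat and has zero k₀-th coordinate.
  have hzero := eq_zero_of_forall_pairing hW (m := fun k => (l k₀ : ℂ) * v k - v k₀ * (l k : ℂ)) (by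
    rintro w (rfl | ⟨i, hi, rfl⟩)
    · simp [Pi.single_apply]
      ring
    · have h1 := hv i (hJl i hi)
      have h2 : ∑ k, (xi i k : ℂ) * (l k : ℂ) = 0 := by
        exact_mod_cast hJl i hi
      have : ∑ k, (xi i k : ℂ) • ((l k₀ : ℂ) * v k - v k₀ * (l k : ℂ)) =
          (l k₀ : ℂ) * (∑ k, (xi i k : ℂ) * v k) - v k₀ * ∑ k, (xi i k : ℂ) * (l k : ℂ) := by
        rw [Finset.mul_sum, Finset.mul_sum, ← Finset.sum_sub_distrib]
        exact Finset.sum_congr rfl fun k _ => by rw [smul_eq_mul]; ring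
      rw [this, h1, h2]
      ring)
  refine ⟨v k₀ / l k₀, fun k => ?_⟩
  have hk := congrFun hzero k
  have : (l k₀ : ℂ) ≠ 0 := by exact_mod_cast hk₀
  simp only [Pi.zero_apply] at hk
  field_simp
  linear_combination hk

/-! ### Functionals on finite-dimensional quotients -/

/-- The largest ideal in the kernel of a linear form. -/
def kernelIdeal {R A : Type*} [CommRing R] [CommRing A] [Algebra R A] (T : A →ₗ[R] R) :
    Ideal A where
  carrier := {f | ∀ g, T (f * g) = 0}
  add_mem' := by
    intro f g hf hg h
    rw [add_mul, map_add, hf, hg, add_zero]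
  zero_mem' := by simp
  smul_mem' := by
    intro a f hf g
    rw [smul_eq_mul, mul_comm a f, mul_assoc, hf]

/-- It suffices that every prime I of the quotient is maximal. Let S be the weights that are
constant modulo I. A nonzero common zero of S would yield a transverse λ killed by S, hence a
product of ξ_i + a with i ∉ S lying in I, against primality. So S has no common zero, all
coordinates are constant modulo I, and the residue ring is ℂ. -/
theorem finite_quotient_kernelIdeal {d n : ℕ} {xi : Fin n → Fin d → ℤ}
    {T : MvPolynomial (Fin d) ℂ →ₗ[ℂ] ℂ}
    (hT : ∀ (S : Set (Fin n)) (l₀ : Fin d → ℤ), l₀ ≠ 0 → (∀ i ∈ S, pairing (xi i) l₀ = 0) →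
      ∃ l, (∀ i ∈ S, pairing (xi i) l = 0) ∧ IsTransverse xi T l) :
    Module.Finite ℂ (MvPolynomial (Fin d) ℂ ⧸ kernelIdeal T) := by
  rw [Module.finite_iff_krullDimLE_zero, Ring.krullDimLE_zero_iff]
  intro I hI
  set A := MvPolynomial (Fin d) ℂ ⧸ kernelIdeal T
  set π : MvPolynomial (Fin d) ℂ →ₐ[ℂ] A := Ideal.Quotient.mkₐ ℂ (kernelIdeal T) with hπ
  set S : Set (Fin n) := {i | ∃ a, π (linearForm (xi i) + MvPolynomial.C a) ∈ I} with hS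
  have hspan : ∀ l₀ : Fin d → ℤ, (∀ w ∈ xi '' S, pairing w l₀ = 0) → l₀ = 0 := by
    intro l₀ hl₀
    by_contra hne
    obtain ⟨l, hl, R, hR, hTR⟩ := hT S l₀ hne fun i hi => hl₀ _ ⟨i, hi, rfl⟩
    have hRI : π R ∈ I := by
      have : π R = 0 := Ideal.Quotient.eq_zero_iff_mem.2 hTR
      rw [this]
      exact I.zero_mem
    have hmem : ∀ p ∈ transverseForms xi l, π p ∉ I := by
      intro p hp
      induction hp using Submonoid.closure_induction with
      | mem p hp =>
        obtain ⟨i, a, hi, rfl⟩ := hp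
        exact fun h => hi (hl i ⟨a, h⟩)
      | one =>
        rw [map_one]
        exact fun h => hI.ne_top ((Ideal.eq_top_iff_one I).2 h)
      | mul p r _ _ hp hr =>
        rw [map_mul]
        exact fun h => (hI.mem_or_mem h).elim hp hr
    exact hmem R hR hRI
  set ψ : MvPolynomial (Fin d) ℂ →ₐ[ℂ] A ⧸ I := (Ideal.Quotient.mkₐ ℂ I).comp π with hψ
  -- Modulo the scalars the weights in S vanish, so linear algebra in (A/I)/ℂ shows that the
  -- coordinates do too.
  set N : Submodule ℂ (A ⧸ I) := LinearMap.range (Algebra.linearMap ℂ (A ⧸ I)) with hN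
  have hX := eq_zero_of_forall_pairing hspan (M := (A ⧸ I) ⧸ N)
    (m := fun k => N.mkQ (ψ (MvPolynomial.X k))) (by
      rintro _ ⟨i, ⟨a, ha⟩, rfl⟩
      have h1 : ψ (linearForm (xi i)) = algebraMap ℂ (A ⧸ I) (-a) := by
        have h0 : ψ (linearForm (xi i) + MvPolynomial.C a) = 0 := Ideal.Quotient.eq_zero_iff_mem.2 ha
        rw [map_add, ← MvPolynomial.algebraMap_eq, AlgHom.commutes] at h0
        rw [map_neg]
        exact eq_neg_of_add_eq_zero_left h0
      have h2 : ∑ k, (xi i k : ℂ) • N.mkQ (ψ (MvPolynomial.X k)) = N.mkQ (ψ (linearForm (xi i))) := by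
        rw [linearForm, map_sum, map_sum]
        refine Finset.sum_congr rfl fun k _ => ?_
        rw [← MvPolynomial.smul_eq_C_mul, map_smul, map_smul]
      rw [h2, h1, Submodule.mkQ_apply, Submodule.Quotient.mk_eq_zero]
      exact ⟨-a, rfl⟩)
  have hX' : ∀ k, ∃ a, algebraMap ℂ (A ⧸ I) a = ψ (MvPolynomial.X k) := by
    intro k
    have := congrFun hX k
    rw [Pi.zero_apply, Submodule.mkQ_apply, Submodule.Quotient.mk_eq_zero] at this
    exact this
  choose a ha using hX'
  have hψa : ψ = (Algebra.ofId ℂ (A ⧸ I)).comp (MvPolynomial.aeval a) := by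
    refine MvPolynomial.algHom_ext fun k => ?_
    rw [AlgHom.comp_apply (Algebra.ofId ℂ (A ⧸ I)), MvPolynomial.aeval_X, Algebra.ofId_apply, ha]
  have hsurj : Function.Surjective (algebraMap ℂ (A ⧸ I)) := by
    intro x
    obtain ⟨p, hp⟩ : ∃ p, ψ p = x := by
      obtain ⟨y, rfl⟩ := Ideal.Quotient.mk_surjective x
      obtain ⟨p, rfl⟩ := Ideal.Quotient.mk_surjective y
      exact ⟨p, rfl⟩
    rw [hψa] at hp
    exact ⟨_, hp⟩
  have : Nontrivial (A ⧸ I) := Ideal.Quotient.nontrivial_iff.2 hI.ne_top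
  rw [Ideal.Quotient.maximal_ideal_iff_isField_quotient]
  exact MulEquiv.isField (Field.toIsField ℂ) (RingEquiv.ofBijective (algebraMap ℂ (A ⧸ I))
    ⟨(algebraMap ℂ (A ⧸ I)).injective, hsurj⟩).symm.toMulEquiv

theorem iteratedDeriv_exp_smul {A : Type*} [NormedRing A] [NormedAlgebra ℂ A] [CompleteSpace A]
    (Λ : A →L[ℂ] ℂ) (x : A) (n : ℕ) :
    iteratedDeriv n (fun t : ℂ => Λ (NormedSpace.exp (t • x))) =
      fun t => Λ (NormedSpace.exp (t • x) * x ^ n) := by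
  induction n with
  | zero => simp
  | succ n ih =>
    rw [iteratedDeriv_succ, ih]
    funext t
    refine HasDerivAt.deriv ?_
    have := ((hasDerivAt_exp_smul_const x t).mul_const (x ^ n))
    rw [mul_assoc, ← pow_succ'] at this
    exact Λ.hasFDerivAt.comp_hasDerivAt t this

/-- The hypothesis is ‖1‖ ≤ 1 rather than ‖1‖ = 1 so as to include the zero algebra, which arises
for T = 0. -/
theorem norm_exp_le_exp_norm {A : Type*} [NormedRing A] [NormedAlgebra ℂ A] [CompleteSpace A]
    (h1 : ‖(1 : A)‖ ≤ 1) (x : A) : ‖NormedSpace.exp x‖ ≤ Real.exp ‖x‖ := by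
  have hpow : ∀ n : ℕ, ‖x ^ n‖ ≤ ‖x‖ ^ n := by
    intro n
    rcases n.eq_zero_or_pos with rfl | hn
    · simpa using h1
    · exact norm_pow_le' x hn
  rw [NormedSpace.exp_eq_tsum ℂ, Real.exp_eq_exp_ℝ, NormedSpace.exp_eq_tsum ℝ]
  refine tsum_of_norm_bounded (NormedSpace.expSeries_summable' (𝕂 := ℝ) ‖x‖).hasSum fun n => ?_
  rw [norm_smul, norm_inv, Complex.norm_natCast, smul_eq_mul]
  gcongr
  exact hpow n

/-- The generating function is Λ(exp ρ(c⟨y,z⟩)): entire in y, with growth controlled by the norm of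
the linear map y ↦ ρ(c⟨y,z⟩). -/
theorem hasTameGenerating_of_algHom {d : ℕ} (c : ℂ) {T : MvPolynomial (Fin d) ℂ →ₗ[ℂ] ℂ}
    {W : Type*} [NormedRing W] [NormedAlgebra ℂ W] [CompleteSpace W] (h1 : ‖(1 : W)‖ ≤ 1)
    (ρ : MvPolynomial (Fin d) ℂ →ₐ[ℂ] W) (Λ : W →L[ℂ] ℂ) (hΛ : ∀ f, Λ (ρ f) = T f) :
    HasTameGenerating c T := by
  let B : LieAlg d →L[ℂ] W := ∑ k, (EuclideanSpace.proj k : LieAlg d →L[ℂ] ℂ).smulRight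
    (c • ρ (MvPolynomial.X k))
  have hB : ∀ y, B y = ρ (scaledForm c y) := by
    intro y
    simp only [B, scaledForm, _root_.sum_apply, map_sum, ContinuousLinearMap.smulRight_apply]
    refine Finset.sum_congr rfl fun k _ => ?_
    rw [← MvPolynomial.smul_eq_C_mul, map_smul, smul_smul, mul_comm]
    rfl
  refine ⟨fun y => Λ (NormedSpace.exp (B y)), ⟨1, ‖Λ‖, ‖B‖, one_pos, by positivity,
    by positivity, ?_, fun y _ => ?_⟩, fun y n => ?_⟩
  · refine Differentiable.differentiableOn ?_
    refine Λ.differentiable.comp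
      (Differentiable.comp (g := (NormedSpace.exp : W → W)) ?_ B.differentiable)
    exact fun x => (NormedSpace.exp_analytic (𝕂 := ℂ) x).differentiableAt
  · refine (Λ.le_opNorm _).trans ?_
    gcongr
    refine (norm_exp_le_exp_norm h1 _).trans ?_
    gcongr
    exact B.le_opNorm y
  · simp only [map_smul]
    rw [iteratedDeriv_exp_smul]
    simp [hB, ← map_pow, hΛ]

/-- A linear form on a finite-dimensional algebra is a matrix coefficient. -/
theorem exists_matrixCoefficient {A : Type*} [CommRing A] [Algebra ℂ A] [Module.Finite ℂ A]
    (T : A →ₗ[ℂ] ℂ) : ∃ (m : ℕ) (ρ : A →ₐ[ℂ] ((Fin m → ℂ) →L[ℂ] (Fin m → ℂ)))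
      (Λ : ((Fin m → ℂ) →L[ℂ] (Fin m → ℂ)) →L[ℂ] ℂ), ∀ a, Λ (ρ a) = T a := by
  let e : A ≃ₗ[ℂ] (Fin (Module.finrank ℂ A) → ℂ) := (Module.finBasis ℂ A).equivFun
  refine ⟨Module.finrank ℂ A, ((Module.End.toContinuousLinearMap _).toAlgHom.comp
      (e.conjAlgEquiv ℂ).toAlgHom).comp (Algebra.lmul ℂ A), LinearMap.toContinuousLinearMap
    { toFun := fun B => T (e.symm (B (e 1)))
      map_add' := by simp
      map_smul' := by simp }, fun a => ?_⟩
  change T (e.symm (e (a * e.symm (e 1)))) = T a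
  rw [e.symm_apply_apply, e.symm_apply_apply, mul_one]

/-- A linear form on `ℂ[𝔱]` that factors through a finite-dimensional quotient ring has a tame
generating function. -/
theorem hasTameGenerating_of_finite {d : ℕ} (c : ℂ) {T : MvPolynomial (Fin d) ℂ →ₗ[ℂ] ℂ}
    (hT : Module.Finite ℂ (MvPolynomial (Fin d) ℂ ⧸ kernelIdeal T)) : HasTameGenerating c T := by
  let T' : (MvPolynomial (Fin d) ℂ ⧸ kernelIdeal T) →ₗ[ℂ] ℂ :=
    ((kernelIdeal T).restrictScalars ℂ).liftQ T (fun f hf => by simpa using hf 1) ∘ₗ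
      (Submodule.Quotient.restrictScalarsEquiv ℂ (kernelIdeal T)).symm.toLinearMap
  obtain ⟨m, ρ, Λ, h⟩ := exists_matrixCoefficient T'
  exact hasTameGenerating_of_algHom c ContinuousLinearMap.norm_id_le
    (ρ.comp (Ideal.Quotient.mkₐ ℂ (kernelIdeal T))) Λ fun f => h _

/-! ### From exponential growth to exponential decay -/

theorem pow_le_factorial_div_mul_exp {b s : ℝ} (hb : 0 < b) (hs : 0 ≤ s) (n : ℕ) :
    s ^ n ≤ n.factorial / b ^ n * Real.exp (b * s) := by
  have := Real.pow_div_factorial_le_exp (b * s) (by positivity) n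
  rw [div_le_iff₀ (by positivity), mul_pow] at this
  rw [div_mul_eq_mul_div, le_div_iff₀ (by positivity)]
  linarith

theorem integrable_exp_neg_mul_norm (d : ℕ) {a : ℝ} (ha : 0 < a) :
    Integrable (fun x : EuclideanSpace ℝ (Fin d) => Real.exp (-a * ‖x‖)) := by
  have h := integrable_one_add_norm (E := EuclideanSpace ℝ (Fin d)) (μ := volume) (r := (d + 1 : ℕ))
    (by simp)
  refine (h.const_mul ((d + 1).factorial / a ^ (d + 1) * Real.exp a)).mono'
    (by fun_prop) (Filter.Eventually.of_forall fun x => ?_)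
  rw [Real.norm_of_nonneg (Real.exp_pos _).le, Real.rpow_neg (by positivity), Real.rpow_natCast,
    ← div_eq_mul_inv, le_div_iff₀ (by positivity)]
  have := pow_le_factorial_div_mul_exp ha (by positivity : 0 ≤ 1 + ‖x‖) (d + 1)
  calc Real.exp (-a * ‖x‖) * (1 + ‖x‖) ^ (d + 1)
      ≤ Real.exp (-a * ‖x‖) * ((d + 1).factorial / a ^ (d + 1) * Real.exp (a * (1 + ‖x‖))) := by
        gcongr
    _ = (d + 1).factorial / a ^ (d + 1) * (Real.exp (-a * ‖x‖) * Real.exp (a * (1 + ‖x‖))) := by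
        ring
    _ = _ := by
        rw [← Real.exp_add, show -a * ‖x‖ + a * (1 + ‖x‖) = a by ring]

/-- The inclusion `ℝ^d ⊆ ℂ^d`. -/
noncomputable def complexify (d : ℕ) : EuclideanSpace ℝ (Fin d) →ₗᵢ[ℝ] LieAlg d where
  toFun v := WithLp.toLp 2 fun k => (v k : ℂ)
  map_add' := by
    intro v w
    ext k
    simp
  map_smul' := by
    intro r v
    ext k
    simp
  norm_map' := by
    intro v
    simp [EuclideanSpace.norm_eq]

@[simp]
theorem complexify_apply {d : ℕ} (v : EuclideanSpace ℝ (Fin d)) (k : Fin d) :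
    complexify d v k = v k := rfl

@[fun_prop]
theorem continuous_complexify (d : ℕ) : Continuous (complexify d) := (complexify d).continuous

/-- The coordinatewise real part. -/
noncomputable def realPart {d : ℕ} (y : LieAlg d) : EuclideanSpace ℝ (Fin d) :=
  WithLp.toLp 2 fun k => (y k).re

@[simp]
theorem realPart_apply {d : ℕ} (y : LieAlg d) (k : Fin d) : realPart y k = (y k).re := rfl

theorem norm_le_sum_norm {d : ℕ} (y : LieAlg d) : ‖y‖ ≤ ∑ k, ‖y k‖ := by
  have h : y = ∑ k, EuclideanSpace.single k (y k) := by
    ext j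
    simp [Pi.single_apply]
  conv_lhs => rw [h]
  refine (norm_sum_le _ _).trans (le_of_eq ?_)
  simp

theorem norm_le_sum_abs_re_add {d : ℕ} {y : LieAlg d} {eps : ℝ} (hy : y ∈ strip d eps) :
    ‖y‖ ≤ ∑ k, |(y k).re| + d * eps := by
  calc ‖y‖ ≤ ∑ k, ‖y k‖ := norm_le_sum_norm y
    _ ≤ ∑ k, (|(y k).re| + eps) := Finset.sum_le_sum fun k _ =>
        (Complex.norm_le_abs_re_add_abs_im _).trans (by linarith [hy k])
    _ = _ := by simp [Finset.sum_add_distrib]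

theorem norm_le_norm_realPart_add {d : ℕ} {y : LieAlg d} {eps : ℝ} (hy : y ∈ strip d eps) :
    ‖y‖ ≤ ‖realPart y‖ + d * eps := by
  have h : y = complexify d (realPart y) + (y - complexify d (realPart y)) := by abel
  conv_lhs => rw [h]
  refine (norm_add_le _ _).trans ?_
  rw [LinearIsometry.norm_map]
  gcongr
  refine (norm_le_sum_norm _).trans ?_
  calc _ ≤ ∑ _k : Fin d, eps := Finset.sum_le_sum fun k _ => by
        have : (y - complexify d (realPart y)) k = ((y k).im : ℂ) * Complex.I := by
          rw [PiLp.sub_apply, complexify_apply, realPart_apply, sub_eq_iff_eq_add', Complex.re_add_im]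
        rw [this]
        simpa using (hy k).le
    _ = _ := by simp

/-- The product of the functions `2 cosh(K y_k)`. -/
noncomputable def coshProd {d : ℕ} (K : ℝ) (y : LieAlg d) : ℂ :=
  ∏ k, (Complex.exp (K * y k) + Complex.exp (-(K * y k)))

theorem differentiable_coshProd {d : ℕ} (K : ℝ) : Differentiable ℂ (coshProd (d := d) K) := by
  unfold coshProd
  fun_prop

theorem coshProd_eq_sum {d : ℕ} (K : ℝ) (y : LieAlg d) :
    coshProd K y = ∑ s : Fin d → Bool,
      Complex.exp (K * ∑ k, (if s k then (1 : ℂ) else -1) * y k) := by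
  have h : ∀ k, Complex.exp (K * y k) + Complex.exp (-(K * y k)) =
      ∑ b : Bool, Complex.exp (K * ((if b then (1 : ℂ) else -1) * y k)) := by
    intro k
    simp
  simp only [coshProd, h]
  rw [Finset.prod_univ_sum, Fintype.piFinset_univ]
  refine Finset.sum_congr rfl fun s _ => ?_
  rw [Finset.mul_sum, Complex.exp_sum]

/-- The real part is (e^{Re z} + e^{-Re z}) cos(Im z), and the cosine is at least 1/2 for |Im z| ≤
1. -/
theorem exp_abs_re_le_norm_cosh {z : ℂ} (hz : |z.im| ≤ 1) :
    Real.exp |z.re| / 2 ≤ ‖Complex.exp z + Complex.exp (-z)‖ := by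
  refine le_trans ?_ (Complex.re_le_norm _)
  rw [Complex.add_re, Complex.exp_re, Complex.exp_re, Complex.neg_re, Complex.neg_im, Real.cos_neg,
    ← add_mul]
  have h1 : 1 / 2 ≤ Real.cos z.im := by
    have := Real.one_sub_sq_div_two_le_cos (x := z.im)
    have h2 : z.im ^ 2 ≤ 1 := by
      rw [← sq_abs]
      exact pow_le_one₀ (abs_nonneg _) hz
    linarith
  have h2 : Real.exp |z.re| ≤ Real.exp z.re + Real.exp (-z.re) := by
    rcases abs_cases z.re with ⟨h, -⟩ | ⟨h, -⟩ <;> rw [h] <;>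
      linarith [Real.exp_pos z.re, Real.exp_pos (-z.re)]
  nlinarith [Real.exp_pos |z.re|]

theorem exp_le_norm_coshProd {d : ℕ} {K eps : ℝ} (hK : 0 < K) (hKe : K * eps ≤ 1) {y : LieAlg d}
    (hy : y ∈ strip d eps) :
    Real.exp (K * (‖y‖ - d * eps)) / 2 ^ d ≤ ‖coshProd K y‖ := by
  rw [coshProd, norm_prod]
  calc Real.exp (K * (‖y‖ - d * eps)) / 2 ^ d ≤ Real.exp (K * ∑ k, |(y k).re|) / 2 ^ d := by
        gcongr
        linarith [norm_le_sum_abs_re_add hy]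
    _ = ∏ k, (Real.exp |K * (y k).re| / 2) := by
        rw [Finset.prod_div_distrib, Finset.mul_sum, Real.exp_sum]
        simp [abs_mul, abs_of_pos hK]
    _ ≤ _ := by
        refine Finset.prod_le_prod (fun k _ => by positivity) fun k _ => ?_
        have := exp_abs_re_le_norm_cosh (z := K * y k) (by
          rw [Complex.im_ofReal_mul, abs_mul, abs_of_pos hK]
          nlinarith [hy k])
        rwa [Complex.re_ofReal_mul] at this

/-- A tame function is a finite sum of exponentials times an exponentially decaying function. -/
theorem IsTame.exists_decay {d : ℕ} {F : LieAlg d → ℂ} (hF : IsTame F) :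
    ∃ K eps C : ℝ, 0 < eps ∧ 0 ≤ C ∧
      DifferentiableOn ℂ (fun y => F y / coshProd K y) (strip d eps) ∧
      (∀ y ∈ strip d eps, ‖F y / coshProd K y‖ ≤ C * Real.exp (-1 * ‖y‖)) ∧
      ∀ y ∈ strip d eps, F y = ∑ s : Fin d → Bool,
        Complex.exp (K * ∑ k, (if s k then (1 : ℂ) else -1) * y k) * (F y / coshProd K y) := by
  obtain ⟨e₀, C, A, he₀, hC, hA, hd, hb⟩ := hF
  -- The product of cosines grows like e^{K|y|}, so it beats e^{A|y|} by e^{|y|}.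
  set K := A + 1 with hK
  have hKp : 0 < K := by positivity
  obtain ⟨eps, heps, hle, hKe⟩ : ∃ eps > 0, eps ≤ e₀ ∧ K * eps ≤ 1 := by
    refine ⟨min e₀ (1 / K), by positivity, min_le_left _ _, ?_⟩
    rw [mul_comm, ← le_div_iff₀ hKp]
    exact min_le_right _ _
  have hlow : ∀ y ∈ strip d eps, Real.exp (K * (‖y‖ - d * eps)) / 2 ^ d ≤ ‖coshProd K y‖ :=
    fun y hy => exp_le_norm_coshProd hKp hKe hy
  have hpos : ∀ y ∈ strip d eps, 0 < ‖coshProd K y‖ := fun y hy =>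
    lt_of_lt_of_le (by positivity) (hlow y hy)
  refine ⟨K, eps, C * Real.exp (K * (d * eps)) * 2 ^ d, heps, by positivity, ?_, ?_, ?_⟩
  · simp only [div_eq_mul_inv]
    exact (hd.mono (strip_mono hle)).mul ((differentiable_coshProd K).differentiableOn.inv
      fun y hy => norm_pos_iff.1 (hpos y hy))
  · intro y hy
    rw [norm_div, div_le_iff₀ (hpos y hy)]
    calc ‖F y‖ ≤ C * Real.exp (A * ‖y‖) := hb y (strip_mono hle hy)
      _ = C * Real.exp (K * (d * eps)) * 2 ^ d * Real.exp (-1 * ‖y‖) *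
          (Real.exp (K * (‖y‖ - d * eps)) / 2 ^ d) := by
        have : A * ‖y‖ = K * (d * eps) + (-1 * ‖y‖) + K * (‖y‖ - d * eps) := by
          rw [hK]
          ring
        rw [this, Real.exp_add, Real.exp_add]
        field_simp
      _ ≤ _ := by
        gcongr
        exact hlow y hy
  · intro y hy
    rw [← Finset.sum_mul, ← coshProd_eq_sum, mul_div_cancel₀ _ (norm_pos_iff.1 (hpos y hy))]

/-! ### Fourier transforms on tubes -/

/-- The bilinear pairing `∑ x_k y_k`. -/
noncomputable def dotProd {d : ℕ} (x y : LieAlg d) : ℂ := ∑ k, x k * y k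

theorem abs_sum_mul_le {d : ℕ} (u : EuclideanSpace ℝ (Fin d)) {f : Fin d → ℝ} {B : ℝ}
    (hf : ∀ k, |f k| ≤ B) : |∑ k, u k * f k| ≤ d * B * ‖u‖ := by
  refine (Finset.abs_sum_le_sum_abs _ _).trans ?_
  calc ∑ k, |u k * f k| ≤ ∑ _k : Fin d, ‖u‖ * B := Finset.sum_le_sum fun k _ => by
        rw [abs_mul]
        have := PiLp.norm_apply_le u k
        rw [Real.norm_eq_abs] at this
        gcongr
        exact hf k
    _ = _ := by
      simp
      ring

/-- The Fourier transform, for complex frequencies, of the restriction of `Ψ` to the real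
space. -/
noncomputable def complexFourier {d : ℕ} (Ψ : LieAlg d → ℂ) (x : LieAlg d) : ℂ :=
  ∫ v : EuclideanSpace ℝ (Fin d),
    Complex.exp (-(2 * Real.pi * Complex.I * dotProd (complexify d v) x)) * Ψ (complexify d v)

theorem norm_exp_dotProd {d : ℕ} (y x : LieAlg d) :
    ‖Complex.exp (-(2 * Real.pi * Complex.I * dotProd y x))‖ =
      Real.exp (2 * Real.pi * (dotProd y x).im) := by
  rw [Complex.norm_exp]
  congr 1
  have : -(2 * Real.pi * Complex.I * dotProd y x) =
      ((-(2 * Real.pi) : ℝ) : ℂ) * (Complex.I * dotProd y x) := by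
    push_cast
    ring
  rw [this, Complex.re_ofReal_mul, Complex.I_mul_re]
  ring

theorem im_dotProd_complexify {d : ℕ} (v : EuclideanSpace ℝ (Fin d)) (x : LieAlg d) :
    (dotProd (complexify d v) x).im = ∑ k, v k * (x k).im := by
  simp [dotProd]

theorem re_dotProd_complexify {d : ℕ} (v : EuclideanSpace ℝ (Fin d)) (x : LieAlg d) :
    (dotProd (complexify d v) x).re = ∑ k, v k * (x k).re := by
  simp [dotProd]

theorem dotProd_add_smul {d : ℕ} (y u x : LieAlg d) (a : ℂ) :
    dotProd (y + a • u) x = dotProd y x + a * dotProd u x := by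
  simp only [dotProd, PiLp.add_apply, PiLp.smul_apply, smul_eq_mul, add_mul, mul_assoc,
    Finset.sum_add_distrib, Finset.mul_sum]

theorem complexify_mem_strip {d : ℕ} (v : EuclideanSpace ℝ (Fin d)) {e : ℝ} (he : 0 < e) :
    complexify d v ∈ strip d e := by
  intro k
  simpa using he

@[fun_prop]
theorem differentiable_dotProd {d : ℕ} (y : LieAlg d) : Differentiable ℂ (dotProd y) := by
  unfold dotProd
  fun_prop

@[fun_prop]
theorem differentiable_dotProd_left {d : ℕ} (y : LieAlg d) :
    Differentiable ℂ fun x => dotProd x y := by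
  unfold dotProd
  fun_prop

theorem differentiableOn_complexFourier {d : ℕ} {Ψ : LieAlg d → ℂ} {e C B δ : ℝ} (he : 0 < e)
    (hB : 0 < B) (hd : DifferentiableOn ℂ Ψ (strip d e))
    (hb : ∀ y ∈ strip d e, ‖Ψ y‖ ≤ C * Real.exp (-B * ‖y‖)) (hδ : 2 * Real.pi * (d * δ) ≤ B / 2) :
    DifferentiableOn ℂ (complexFourier Ψ) (strip d δ) := by
  refine differentiableOn_integral_of_dominated (isOpen_strip d δ)
    (g := fun v : EuclideanSpace ℝ (Fin d) => C * Real.exp (-(B / 2) * ‖v‖)) ?_ ?_ ?_ ?_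
  · intro v
    exact Differentiable.differentiableOn (by fun_prop)
  · intro x _
    refine Continuous.aestronglyMeasurable (Continuous.mul ?_ ?_)
    · have := (differentiable_dotProd_left x).continuous
      fun_prop
    · exact hd.continuousOn.comp_continuous (by fun_prop) fun v => complexify_mem_strip v he
  · exact (integrable_exp_neg_mul_norm d (by positivity)).const_mul C
  · intro x hx v
    rw [norm_mul, norm_exp_dotProd, im_dotProd_complexify]
    have h1 := abs_sum_mul_le v (f := fun k => (x k).im) (B := δ) fun k => (hx k).le
    have h2 := hb _ (complexify_mem_strip v he)
    rw [LinearIsometry.norm_map] at h2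
    calc _ ≤ Real.exp (B / 2 * ‖v‖) * (C * Real.exp (-B * ‖v‖)) := by
          refine mul_le_mul (Real.exp_le_exp.2 ?_) h2 (norm_nonneg _) (by positivity)
          calc 2 * Real.pi * ∑ k, v k * (x k).im ≤ 2 * Real.pi * (d * δ * ‖v‖) := by
                gcongr
                exact (le_abs_self _).trans h1
            _ = 2 * Real.pi * (d * δ) * ‖v‖ := by ring
            _ ≤ _ := by gcongr
      _ = C * (Real.exp (B / 2 * ‖v‖) * Real.exp (-B * ‖v‖)) := by ring
      _ = _ := by
          rw [← Real.exp_add]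
          congr 2
          ring

/-- Shift of the domain of integration by an imaginary vector. -/
theorem complexFourier_eq_shifted {d : ℕ} {Ψ : LieAlg d → ℂ} {e C B δ : ℝ} (he : 0 < e)
    (hC : 0 ≤ C) (hB : 0 < B) (hd : DifferentiableOn ℂ Ψ (strip d e))
    (hb : ∀ y ∈ strip d e, ‖Ψ y‖ ≤ C * Real.exp (-B * ‖y‖)) (hδ : 2 * Real.pi * (d * δ) ≤ B / 2)
    {x : LieAlg d} (hx : x ∈ strip d δ) {u : EuclideanSpace ℝ (Fin d)} (hu : ‖u‖ ≤ e / 4) :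
    complexFourier Ψ x = ∫ v : EuclideanSpace ℝ (Fin d),
      Complex.exp (-(2 * Real.pi * Complex.I *
        dotProd (complexify d v + (-Complex.I) • complexify d u) x)) *
      Ψ (complexify d v + (-Complex.I) • complexify d u) := by
  -- The contour is displaced by a u with a complex parameter a. For |a| < 2 it stays in the tube,
  -- since 2|u| ≤ e/2.
  set f : ℂ → EuclideanSpace ℝ (Fin d) → ℂ := fun a v =>
    Complex.exp (-(2 * Real.pi * Complex.I * dotProd (complexify d v + a • complexify d u) x)) *
      Ψ (complexify d v + a • complexify d u) with hf
  have hmem : ∀ a ∈ Metric.ball (0 : ℂ) 2, ∀ v : EuclideanSpace ℝ (Fin d),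
      complexify d v + a • complexify d u ∈ strip d e := by
    intro a ha v k
    have h1 : |a.im| < 2 := (Complex.abs_im_le_norm a).trans_lt (by simpa using ha)
    have h2 := PiLp.norm_apply_le u k
    rw [Real.norm_eq_abs] at h2
    have h3 : ((complexify d v + a • complexify d u) k).im = a.im * u k := by simp
    rw [h3, abs_mul]
    nlinarith [abs_nonneg (u k), abs_nonneg a.im]
  have hdiff : DifferentiableOn ℂ (fun a => ∫ v, f a v) (Metric.ball 0 2) := by
    refine differentiableOn_integral_of_dominated Metric.isOpen_ball
      (g := fun v : EuclideanSpace ℝ (Fin d) =>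
        Real.exp (2 * Real.pi * (2 * ‖dotProd (complexify d u) x‖) + B * (2 * ‖u‖)) *
          (C * Real.exp (-(B / 2) * ‖v‖))) ?_ ?_ ?_ ?_
    · intro v
      refine DifferentiableOn.mul (Differentiable.differentiableOn ?_) ?_
      · have := differentiable_dotProd_left x
        fun_prop
      · exact hd.comp (by fun_prop) fun a ha => hmem a ha v
    · intro a ha
      refine Continuous.aestronglyMeasurable (Continuous.mul ?_ ?_)
      · have := (differentiable_dotProd_left x).continuous
        fun_prop
      · exact hd.continuousOn.comp_continuous (by fun_prop) (hmem a ha)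
    · exact ((integrable_exp_neg_mul_norm d (by positivity)).const_mul C).const_mul _
    · intro a ha v
      have ha2 : ‖a‖ ≤ 2 := by simpa using (Metric.mem_ball.1 ha).le
      have h1 := abs_sum_mul_le v (f := fun k => (x k).im) (B := δ) fun k => (hx k).le
      have h2 := hb _ (hmem a ha v)
      have h3 : ‖v‖ - 2 * ‖u‖ ≤ ‖complexify d v + a • complexify d u‖ := by
        have := norm_sub_norm_le (complexify d v) (-(a • complexify d u))
        rw [sub_neg_eq_add, norm_neg, norm_smul, LinearIsometry.norm_map,
          LinearIsometry.norm_map] at this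
        nlinarith [norm_nonneg u]
      have h4 : (dotProd (complexify d v + a • complexify d u) x).im ≤
          d * δ * ‖v‖ + 2 * ‖dotProd (complexify d u) x‖ := by
        rw [dotProd_add_smul, Complex.add_im, im_dotProd_complexify]
        refine add_le_add ((le_abs_self _).trans h1) ?_
        refine (le_abs_self _).trans ((Complex.abs_im_le_norm _).trans ?_)
        rw [norm_mul]
        gcongr
      simp only [hf]
      rw [norm_mul, norm_exp_dotProd]
      calc _ ≤ Real.exp (2 * Real.pi * (2 * ‖dotProd (complexify d u) x‖) + B / 2 * ‖v‖) *
            (C * Real.exp (B * (2 * ‖u‖) + -B * ‖v‖)) := by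
            refine mul_le_mul (Real.exp_le_exp.2 ?_) (h2.trans ?_) (norm_nonneg _) (by positivity)
            · have h5 : 2 * Real.pi * (d * δ) * ‖v‖ ≤ B / 2 * ‖v‖ := by gcongr
              have h6 := mul_le_mul_of_nonneg_left h4 (by positivity : 0 ≤ 2 * Real.pi)
              linarith
            · gcongr
              nlinarith
        _ = C * (Real.exp (2 * Real.pi * (2 * ‖dotProd (complexify d u) x‖) + B / 2 * ‖v‖) *
            Real.exp (B * (2 * ‖u‖) + -B * ‖v‖)) := by ring
        _ = C * (Real.exp (2 * Real.pi * (2 * ‖dotProd (complexify d u) x‖) + B * (2 * ‖u‖)) *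
            Real.exp (-(B / 2) * ‖v‖)) := by
            rw [← Real.exp_add, ← Real.exp_add]
            congr 2
            ring
        _ = _ := by ring
  have hreal : ∀ t : ℝ, ∫ v, f t v = ∫ v, f 0 v := by
    intro t
    have h := integral_add_right_eq_self (μ := volume) (f 0) (t • u)
    rw [← h]
    refine integral_congr_ae (Filter.Eventually.of_forall fun v => ?_)
    have : complexify d (v + t • u) = complexify d v + (t : ℂ) • complexify d u := by
      rw [map_add, map_smul]
      rfl
    simp only [hf, this, zero_smul, add_zero]
  -- The integral is holomorphic in a and, by translation invariance, constant for real a; hence it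
  -- is constant on the disc, which contains -i.
  have hconst : Set.EqOn (fun a => ∫ v, f a v) (fun _ => ∫ v, f 0 v) (Metric.ball 0 2) := by
    refine (hdiff.analyticOnNhd Metric.isOpen_ball).eqOn_of_preconnected_of_frequently_eq
      analyticOnNhd_const (convex_ball 0 2).isPreconnected (Metric.mem_ball_self two_pos) ?_
    have hu : Filter.Tendsto (fun n : ℕ => (((1 / ((n : ℝ) + 1) : ℝ)) : ℂ)) Filter.atTop
        (nhdsWithin 0 {0}ᶜ) := by
      rw [tendsto_nhdsWithin_iff]
      constructor
      · exact (Complex.continuous_ofReal.tendsto 0).comp tendsto_one_div_add_atTop_nhds_zero_nat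
      · refine Filter.Eventually.of_forall fun n => ?_
        have : (1 / ((n : ℝ) + 1)) ≠ 0 := by positivity
        exact Complex.ofReal_ne_zero.2 this
    exact hu.frequently (Filter.Frequently.of_forall fun n => hreal _)
  have hI := hconst (show -Complex.I ∈ Metric.ball (0 : ℂ) 2 by simp)
  simp only at hI
  calc complexFourier Ψ x = ∫ v, f 0 v := by
        simp only [complexFourier, hf, zero_smul, add_zero]
    _ = _ := hI.symm

/-- Shift the contour by -i u, with u of length e/4 along Re x: the kernel then contributes
e^{-2π(e/4)|Re x|}. Half of the decay rate B absorbs the growth caused by Im x. -/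
theorem exists_norm_complexFourier_le {d : ℕ} {Ψ : LieAlg d → ℂ} {e C B δ : ℝ} (he : 0 < e)
    (hC : 0 ≤ C) (hB : 0 < B) (hd : DifferentiableOn ℂ Ψ (strip d e))
    (hb : ∀ y ∈ strip d e, ‖Ψ y‖ ≤ C * Real.exp (-B * ‖y‖)) (hδ : 2 * Real.pi * (d * δ) ≤ B / 2) :
    ∃ C' a : ℝ, 0 < a ∧ 0 ≤ C' ∧
      ∀ x ∈ strip d δ, ‖complexFourier Ψ x‖ ≤ C' * Real.exp (-a * ‖x‖) := by
  set I := ∫ v : EuclideanSpace ℝ (Fin d), Real.exp (-(B / 2) * ‖v‖) with hI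
  have hI0 : 0 ≤ I := integral_nonneg fun v => (Real.exp_pos _).le
  set a := 2 * Real.pi * (e / 4) with ha
  have hap : 0 < a := by positivity
  refine ⟨Real.exp (a * (d * δ)) * (Real.exp (B * (e / 4)) * C) * I, a, hap, by positivity,
    fun x hx => ?_⟩
  set r := realPart x with hr
  -- For r = 0 this is u = 0, which is also correct.
  set u : EuclideanSpace ℝ (Fin d) := (e / 4 / ‖r‖) • r with hu
  have hun : ‖u‖ ≤ e / 4 := by
    rw [hu, norm_smul, norm_div, norm_norm, Real.norm_of_nonneg (by positivity)]
    rcases eq_or_ne ‖r‖ 0 with h | h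
    · rw [h]
      simp
      positivity
    · rw [div_mul_cancel₀ _ h]
  have hur : ∑ k, u k * (x k).re = e / 4 * ‖r‖ := by
    have h1 : ∑ k, u k * (x k).re = e / 4 / ‖r‖ * ∑ k, r k ^ 2 := by
      rw [Finset.mul_sum]
      refine Finset.sum_congr rfl fun k _ => ?_
      simp [hu, hr]
      ring
    have h2 : ∑ k, r k ^ 2 = ‖r‖ ^ 2 := by
      rw [EuclideanSpace.norm_sq_eq]
      simp
    rw [h1, h2]
    rcases eq_or_ne ‖r‖ 0 with h | h
    · rw [h]
      simp
    · field_simp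
  have hmem : ∀ v : EuclideanSpace ℝ (Fin d),
      complexify d v + (-Complex.I) • complexify d u ∈ strip d e := by
    intro v k
    have h2 := PiLp.norm_apply_le u k
    rw [Real.norm_eq_abs] at h2
    have h3 : ((complexify d v + (-Complex.I) • complexify d u) k).im = -u k := by simp
    rw [h3, abs_neg]
    linarith
  have hpt : ∀ v : EuclideanSpace ℝ (Fin d), ‖Complex.exp (-(2 * Real.pi * Complex.I *
        dotProd (complexify d v + (-Complex.I) • complexify d u) x)) *
      Ψ (complexify d v + (-Complex.I) • complexify d u)‖ ≤
      Real.exp (-a * ‖r‖) * (Real.exp (B * (e / 4)) * C) * Real.exp (-(B / 2) * ‖v‖) := by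
    intro v
    have h1 := abs_sum_mul_le v (f := fun k => (x k).im) (B := δ) fun k => (hx k).le
    have h2 := hb _ (hmem v)
    have h3 : ‖v‖ - e / 4 ≤ ‖complexify d v + (-Complex.I) • complexify d u‖ := by
      have := norm_sub_norm_le (complexify d v) (-((-Complex.I) • complexify d u))
      rw [sub_neg_eq_add, norm_neg, norm_smul, LinearIsometry.norm_map,
        LinearIsometry.norm_map] at this
      simp only [norm_neg, Complex.norm_I, one_mul] at this
      linarith
    have h4 : (dotProd (complexify d v + (-Complex.I) • complexify d u) x).im ≤
        d * δ * ‖v‖ - e / 4 * ‖r‖ := by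
      rw [dotProd_add_smul, Complex.add_im, im_dotProd_complexify, neg_mul, Complex.neg_im,
        Complex.I_mul_im, re_dotProd_complexify, hur]
      linarith [le_abs_self (∑ k, v k * (x k).im)]
    rw [norm_mul, norm_exp_dotProd]
    calc _ ≤ Real.exp (-a * ‖r‖ + B / 2 * ‖v‖) * (C * Real.exp (B * (e / 4) + -B * ‖v‖)) := by
          refine mul_le_mul (Real.exp_le_exp.2 ?_) (h2.trans ?_) (norm_nonneg _) (by positivity)
          · have h5 : 2 * Real.pi * (d * δ) * ‖v‖ ≤ B / 2 * ‖v‖ := by gcongr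
            have h6 := mul_le_mul_of_nonneg_left h4 (by positivity : 0 ≤ 2 * Real.pi)
            rw [ha]
            linarith
          · gcongr
            nlinarith
      _ = C * (Real.exp (-a * ‖r‖ + B / 2 * ‖v‖) * Real.exp (B * (e / 4) + -B * ‖v‖)) := by ring
      _ = C * (Real.exp (-a * ‖r‖) * Real.exp (B * (e / 4)) * Real.exp (-(B / 2) * ‖v‖)) := by
          rw [← Real.exp_add, ← Real.exp_add, ← Real.exp_add]
          congr 2
          ring
      _ = _ := by ring
  rw [complexFourier_eq_shifted he hC hB hd hb hδ hx hun]
  refine (norm_integral_le_of_norm_le ((integrable_exp_neg_mul_norm d (by positivity :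
    0 < B / 2)).const_mul _) (Filter.Eventually.of_forall hpt)).trans ?_
  rw [integral_const_mul, ← hI]
  calc _ ≤ Real.exp (a * (d * δ) + -a * ‖x‖) * (Real.exp (B * (e / 4)) * C) * I := by
        gcongr
        nlinarith [norm_le_norm_realPart_add hx]
    _ = _ := by
        rw [Real.exp_add]
        ring

theorem dotProd_complexify {d : ℕ} (x y : EuclideanSpace ℝ (Fin d)) :
    dotProd (complexify d x) (complexify d y) = ((inner ℝ x y : ℝ) : ℂ) := by
  simp only [dotProd, complexify_apply, PiLp.inner_apply, RCLike.inner_apply, conj_trivial]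
  push_cast
  exact Finset.sum_congr rfl fun k _ => mul_comm _ _

/-- Fourier inversion for functions which are holomorphic and exponentially decaying on a strip. -/
theorem eq_integral_complexFourier {d : ℕ} {Ψ : LieAlg d → ℂ} {e C B δ : ℝ} (he : 0 < e)
    (hC : 0 ≤ C) (hB : 0 < B) (hδ0 : 0 < δ) (hd : DifferentiableOn ℂ Ψ (strip d e))
    (hb : ∀ y ∈ strip d e, ‖Ψ y‖ ≤ C * Real.exp (-B * ‖y‖)) (hδ : 2 * Real.pi * (d * δ) ≤ B / 2)
    (y : EuclideanSpace ℝ (Fin d)) :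
    Ψ (complexify d y) = ∫ x, Complex.exp (2 * Real.pi * Complex.I *
      dotProd (complexify d x) (complexify d y)) * complexFourier Ψ (complexify d x) := by
  have hcont : Continuous fun v => Ψ (complexify d v) :=
    hd.continuousOn.comp_continuous (by fun_prop) fun v => complexify_mem_strip v he
  have hint : Integrable fun v => Ψ (complexify d v) := by
    refine ((integrable_exp_neg_mul_norm d hB).const_mul C).mono' hcont.aestronglyMeasurable
      (Filter.Eventually.of_forall fun v => ?_)
    simpa using hb _ (complexify_mem_strip v he)
  have hfour : FourierTransform.fourier (fun v => Ψ (complexify d v)) =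
      fun x => complexFourier Ψ (complexify d x) := by
    funext x
    rw [Real.fourier_eq', complexFourier]
    refine integral_congr_ae (Filter.Eventually.of_forall fun v => ?_)
    simp only [dotProd_complexify, smul_eq_mul]
    congr 2
    push_cast
    ring
  obtain ⟨C', a, ha, hC', hdec⟩ := exists_norm_complexFourier_le he hC hB hd hb hδ
  have hint' : Integrable (FourierTransform.fourier fun v => Ψ (complexify d v)) := by
    rw [hfour]
    refine ((integrable_exp_neg_mul_norm d ha).const_mul C').mono' ?_
      (Filter.Eventually.of_forall fun v => ?_)
    · exact ((differentiableOn_complexFourier he hB hd hb hδ).continuousOn.comp_continuous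
        (by fun_prop) fun v => complexify_mem_strip v hδ0).aestronglyMeasurable
    · simpa using hdec _ (complexify_mem_strip v hδ0)
  have h := congrFun (hcont.fourierInv_fourier_eq hint hint') y
  rw [hfour, Real.fourierInv_eq'] at h
  rw [← h]
  refine integral_congr_ae (Filter.Eventually.of_forall fun v => ?_)
  simp only [dotProd_complexify, smul_eq_mul]
  congr 2
  push_cast
  ring

/-- A function which is holomorphic and exponentially decaying on a strip is the Fourier transform
of such a function. -/
theorem exists_eq_integral_exp_mul {d : ℕ} {Φ : LieAlg d → ℂ} {e C : ℝ} (he : 0 < e)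
    (hC : 0 ≤ C) (hd : DifferentiableOn ℂ Φ (strip d e))
    (hb : ∀ y ∈ strip d e, ‖Φ y‖ ≤ C * Real.exp (-1 * ‖y‖)) :
    ∃ (w : LieAlg d → ℂ) (δ C' a : ℝ), 0 < δ ∧ 0 < a ∧ 0 ≤ C' ∧
      DifferentiableOn ℂ w (strip d δ) ∧ (∀ x ∈ strip d δ, ‖w x‖ ≤ C' * Real.exp (-a * ‖x‖)) ∧
      ∀ y, Φ (complexify d y) = ∫ x,
        Complex.exp (Complex.I * dotProd (complexify d x) (complexify d y)) *
          w (complexify d x) := by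
  have hpi : (0 : ℝ) < 2 * Real.pi := by positivity
  -- Rescaling by 2π converts between the kernels e^{2πi⟨x,y⟩} and e^{i⟨x,y⟩}; the decay rate
  -- becomes 2π.
  set Ψ : LieAlg d → ℂ := fun y => Φ ((2 * Real.pi : ℂ) • y) with hΨ
  have hn : ‖(2 * Real.pi : ℂ)‖ = 2 * Real.pi := by
    simp [abs_of_pos Real.pi_pos]
  have hmem : ∀ y ∈ strip d (e / (2 * Real.pi)), (2 * Real.pi : ℂ) • y ∈ strip d e := by
    intro y hy k
    have : ((2 * Real.pi : ℂ) • y) k = ((2 * Real.pi : ℝ) : ℂ) * y k := by simp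
    rw [this, Complex.im_ofReal_mul, abs_mul, abs_of_pos hpi]
    have := hy k
    rw [lt_div_iff₀ hpi] at this
    linarith
  have he' : 0 < e / (2 * Real.pi) := by positivity
  have hd' : DifferentiableOn ℂ Ψ (strip d (e / (2 * Real.pi))) :=
    hd.comp (by fun_prop) hmem
  have hb' : ∀ y ∈ strip d (e / (2 * Real.pi)), ‖Ψ y‖ ≤ C * Real.exp (-(2 * Real.pi) * ‖y‖) := by
    intro y hy
    have := hb _ (hmem y hy)
    rw [norm_smul, hn] at this
    refine this.trans (le_of_eq ?_)
    ring_nf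
  -- Chosen so that d δ ≤ 1/2; the d + 1 avoids division by zero when d = 0.
  set δ : ℝ := 1 / (2 * (d + 1)) with hδ
  have hδ0 : 0 < δ := by positivity
  have hdδ : 2 * Real.pi * (d * δ) ≤ 2 * Real.pi / 2 := by
    have : (d : ℝ) * δ ≤ 1 / 2 := by
      rw [hδ, mul_one_div, div_le_div_iff₀ (by positivity) (by norm_num)]
      linarith
    nlinarith
  obtain ⟨C', a, ha, hC', hdec⟩ := exists_norm_complexFourier_le he' hC hpi hd' hb' hdδ
  refine ⟨complexFourier Ψ, δ, C', a, hδ0, ha, hC',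
    differentiableOn_complexFourier he' hpi hd' hb' hdδ, hdec, fun y => ?_⟩
  have h := eq_integral_complexFourier he' hC hpi hδ0 hd' hb' hdδ ((2 * Real.pi)⁻¹ • y)
  have hy : Ψ (complexify d ((2 * Real.pi)⁻¹ • y)) = Φ (complexify d y) := by
    simp only [hΨ]
    congr 1
    ext k
    have : (Real.pi : ℂ) ≠ 0 := by exact_mod_cast Real.pi_ne_zero
    simp
    field_simp
  rw [← hy, h]
  refine integral_congr_ae (Filter.Eventually.of_forall fun x => ?_)
  simp only [dotProd_complexify, inner_smul_right]
  congr 2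
  push_cast
  have : (Real.pi : ℂ) ≠ 0 := by exact_mod_cast Real.pi_ne_zero
  field_simp

/-! ### Representing the functional by contour integrals -/

/-- In the bound e^{r|g|} one factor e^{r|g|/2} absorbs the power of g and the other absorbs e^{tg}
for |t| < r/2, so a single exponential moment dominates all derivatives. -/
theorem hasDerivAt_integral_pow_mul_exp {α : Type*} [MeasurableSpace α] {μ : Measure α}
    {g w : α → ℂ} {r : ℝ} (hr : 0 < r) (hg : AEStronglyMeasurable g μ)
    (hw : AEStronglyMeasurable w μ) (hint : Integrable (fun x => Real.exp (r * ‖g x‖) * ‖w x‖) μ)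
    (n : ℕ) {t : ℂ} (ht : t ∈ Metric.ball (0 : ℂ) (r / 2)) :
    HasDerivAt (fun t : ℂ => ∫ x, g x ^ n * Complex.exp (t * g x) * w x ∂μ)
      (∫ x, g x ^ (n + 1) * Complex.exp (t * g x) * w x ∂μ) t := by
  have hbound : ∀ m : ℕ, ∀ s ∈ Metric.ball (0 : ℂ) (r / 2), ∀ x,
      ‖g x ^ m * Complex.exp (s * g x) * w x‖ ≤
        m.factorial / (r / 2) ^ m * (Real.exp (r * ‖g x‖) * ‖w x‖) := by
    intro m s hs x
    have h1 := pow_le_factorial_div_mul_exp (half_pos hr) (norm_nonneg (g x)) m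
    have h2 : ‖Complex.exp (s * g x)‖ ≤ Real.exp (r / 2 * ‖g x‖) := by
      refine (Complex.norm_exp_le_exp_norm _).trans (Real.exp_le_exp.2 ?_)
      rw [norm_mul]
      have : ‖s‖ < r / 2 := by simpa using hs
      gcongr
    rw [norm_mul, norm_mul, norm_pow]
    calc _ ≤ (m.factorial / (r / 2) ^ m * Real.exp (r / 2 * ‖g x‖)) * Real.exp (r / 2 * ‖g x‖) *
          ‖w x‖ := by gcongr
      _ = m.factorial / (r / 2) ^ m * ((Real.exp (r / 2 * ‖g x‖) * Real.exp (r / 2 * ‖g x‖)) *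
          ‖w x‖) := by ring
      _ = _ := by
        rw [← Real.exp_add]
        ring_nf
  have hm : ∀ (m : ℕ) (s : ℂ),
      AEStronglyMeasurable (fun x => g x ^ m * Complex.exp (s * g x) * w x) μ := fun m s =>
    ((hg.pow m).mul (Complex.continuous_exp.comp_aestronglyMeasurable (hg.const_mul s))).mul hw
  refine (hasDerivAt_integral_of_dominated_loc_of_deriv_le
    (bound := fun x => (n + 1).factorial / (r / 2) ^ (n + 1) * (Real.exp (r * ‖g x‖) * ‖w x‖))
    (F' := fun t x => g x ^ (n + 1) * Complex.exp (t * g x) * w x)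
    (Metric.isOpen_ball.mem_nhds ht) (Filter.Eventually.of_forall (hm n))
    ((hint.const_mul _).mono' (hm n t) (Filter.Eventually.of_forall (hbound n t ht)))
    (hm (n + 1) t) (Filter.Eventually.of_forall fun x s hs => hbound (n + 1) s hs x)
    (hint.const_mul _) (Filter.Eventually.of_forall fun x s _ => ?_)).2
  refine ((((hasDerivAt_id s).mul_const (g x)).cexp.const_mul (g x ^ n)).mul_const
    (w x)).congr_deriv ?_
  simp only [id_eq]
  ring

theorem iteratedDeriv_integral_exp {α : Type*} [MeasurableSpace α] {μ : Measure α}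
    {g w : α → ℂ} {r : ℝ} (hr : 0 < r) (hg : AEStronglyMeasurable g μ)
    (hw : AEStronglyMeasurable w μ) (hint : Integrable (fun x => Real.exp (r * ‖g x‖) * ‖w x‖) μ)
    (n : ℕ) : ∀ t ∈ Metric.ball (0 : ℂ) (r / 2),
      iteratedDeriv n (fun t : ℂ => ∫ x, Complex.exp (t * g x) * w x ∂μ) t =
        ∫ x, g x ^ n * Complex.exp (t * g x) * w x ∂μ := by
  induction n with
  | zero => simp
  | succ n ih =>
    intro t ht
    rw [iteratedDeriv_succ, Filter.EventuallyEq.deriv_eq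
      (Filter.eventuallyEq_of_mem (Metric.isOpen_ball.mem_nhds ht) ih)]
    exact (hasDerivAt_integral_pow_mul_exp hr hg hw hint n ht).deriv

theorem differentiableOn_integral_exp {α : Type*} [MeasurableSpace α] {μ : Measure α}
    {g w : α → ℂ} {r : ℝ} (hr : 0 < r) (hg : AEStronglyMeasurable g μ)
    (hw : AEStronglyMeasurable w μ) (hint : Integrable (fun x => Real.exp (r * ‖g x‖) * ‖w x‖) μ) :
    DifferentiableOn ℂ (fun t : ℂ => ∫ x, Complex.exp (t * g x) * w x ∂μ)
      (Metric.ball 0 (r / 2)) := by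
  intro t ht
  have h := hasDerivAt_integral_pow_mul_exp hr hg hw hint 0 ht
  simp only [pow_zero, one_mul] at h
  exact h.differentiableAt.differentiableWithinAt

/-- The affine map `x ↦ c⁻¹ (i x + K s)` on which the weights are integrated. -/
noncomputable def contour {d : ℕ} (c : ℂ) (K : ℝ) (s : Fin d → Bool)
    (x : EuclideanSpace ℝ (Fin d)) (k : Fin d) : ℂ :=
  c⁻¹ * (Complex.I * x k + K * (if s k then (1 : ℂ) else -1))

@[fun_prop]
theorem continuous_contour {d : ℕ} (c : ℂ) (K : ℝ) (s : Fin d → Bool) :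
    Continuous (contour c K s) := by
  unfold contour
  fun_prop

theorem eval_contour_scaledForm {d : ℕ} {c : ℂ} (hc : c ≠ 0) (K : ℝ) (s : Fin d → Bool)
    (x : EuclideanSpace ℝ (Fin d)) (y : LieAlg d) :
    MvPolynomial.eval (contour c K s x) (scaledForm c y) =
      Complex.I * dotProd (complexify d x) y + K * ∑ k, (if s k then (1 : ℂ) else -1) * y k := by
  simp only [scaledForm, contour, dotProd, map_sum, map_mul, MvPolynomial.eval_C,
    MvPolynomial.eval_X, Finset.mul_sum, ← Finset.sum_add_distrib, complexify_apply]
  refine Finset.sum_congr rfl fun k _ => ?_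
  field_simp

theorem exists_norm_eval_contour_le {d : ℕ} (c : ℂ) (K : ℝ) (s : Fin d → Bool)
    (R : MvPolynomial (Fin d) ℂ) : ∀ b : ℝ, 0 < b → ∃ C : ℝ, 0 ≤ C ∧
      ∀ x, ‖MvPolynomial.eval (contour c K s x) R‖ ≤ C * Real.exp (b * ‖x‖) := by
  induction R using MvPolynomial.induction_on with
  | C a =>
    refine fun b hb => ⟨‖a‖, norm_nonneg _, fun x => ?_⟩
    rw [MvPolynomial.eval_C]
    exact le_mul_of_one_le_right (norm_nonneg _) (Real.one_le_exp (by positivity))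
  | add p q hp hq =>
    intro b hb
    obtain ⟨C₁, h₁, h₁'⟩ := hp b hb
    obtain ⟨C₂, h₂, h₂'⟩ := hq b hb
    refine ⟨C₁ + C₂, by positivity, fun x => ?_⟩
    rw [map_add, add_mul]
    exact (norm_add_le _ _).trans (add_le_add (h₁' x) (h₂' x))
  | mul_X p k hp =>
    intro b hb
    obtain ⟨C₁, h₁, h₁'⟩ := hp (b / 2) (half_pos hb)
    refine ⟨C₁ * (‖c⁻¹‖ * (1 / (b / 2) + |K|)), by positivity, fun x => ?_⟩
    have h2 : ‖contour c K s x k‖ ≤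
        ‖c⁻¹‖ * (1 / (b / 2) + |K|) * Real.exp (b / 2 * ‖x‖) := by
      have h3 := pow_le_factorial_div_mul_exp (half_pos hb) (norm_nonneg x) 1
      have h4 := PiLp.norm_apply_le x k
      have h5 : ‖(if s k then (1 : ℂ) else -1)‖ = 1 := by split_ifs <;> simp
      have h6 : 1 ≤ Real.exp (b / 2 * ‖x‖) := Real.one_le_exp (by positivity)
      rw [contour, norm_mul, mul_assoc]
      gcongr
      refine (norm_add_le _ _).trans ?_
      rw [norm_mul, norm_mul, h5, Complex.norm_I, one_mul, mul_one, Complex.norm_real,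
        Complex.norm_real, Real.norm_eq_abs K, add_mul]
      refine add_le_add (h4.trans ?_) (le_mul_of_one_le_right (abs_nonneg _) h6)
      simpa using h3
    rw [map_mul, MvPolynomial.eval_X, norm_mul]
    calc _ ≤ (C₁ * Real.exp (b / 2 * ‖x‖)) *
          (‖c⁻¹‖ * (1 / (b / 2) + |K|) * Real.exp (b / 2 * ‖x‖)) := by
          gcongr
          exact h₁' x
      _ = C₁ * (‖c⁻¹‖ * (1 / (b / 2) + |K|)) *
          (Real.exp (b / 2 * ‖x‖) * Real.exp (b / 2 * ‖x‖)) := by ring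
      _ = _ := by
        rw [← Real.exp_add]
        ring_nf

theorem integrable_eval_contour_mul {d : ℕ} (c : ℂ) (K : ℝ) (s : Fin d → Bool)
    {w : LieAlg d → ℂ} {C a : ℝ} (ha : 0 < a) (hw : Continuous fun x => w (complexify d x))
    (hb : ∀ x, ‖w (complexify d x)‖ ≤ C * Real.exp (-a * ‖x‖)) (R : MvPolynomial (Fin d) ℂ) :
    Integrable fun x => MvPolynomial.eval (contour c K s x) R * w (complexify d x) := by
  obtain ⟨C₁, h₁, h₁'⟩ := exists_norm_eval_contour_le c K s R (a / 2) (half_pos ha)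
  refine ((integrable_exp_neg_mul_norm d (half_pos ha)).const_mul (C₁ * C)).mono' ?_
    (Filter.Eventually.of_forall fun x => ?_)
  · exact (((MvPolynomial.continuous_eval R).comp (continuous_contour c K s)).mul
      hw).aestronglyMeasurable
  · rw [norm_mul]
    calc _ ≤ (C₁ * Real.exp (a / 2 * ‖x‖)) * (C * Real.exp (-a * ‖x‖)) :=
          mul_le_mul (h₁' x) (hb x) (norm_nonneg _) (by positivity)
      _ = C₁ * C * (Real.exp (a / 2 * ‖x‖) * Real.exp (-a * ‖x‖)) := by ring
      _ = _ := by
        rw [← Real.exp_add]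
        ring_nf

/-- Integration of polynomials along a contour. -/
noncomputable def contourIntegral {d : ℕ} (c : ℂ) (K : ℝ) (s : Fin d → Bool)
    {w : LieAlg d → ℂ} {C a : ℝ} (ha : 0 < a) (hw : Continuous fun x => w (complexify d x))
    (hb : ∀ x, ‖w (complexify d x)‖ ≤ C * Real.exp (-a * ‖x‖)) :
    MvPolynomial (Fin d) ℂ →ₗ[ℂ] ℂ where
  toFun R := ∫ x, MvPolynomial.eval (contour c K s x) R * w (complexify d x)
  map_add' p q := by
    simp only [map_add, add_mul]
    exact integral_add (integrable_eval_contour_mul c K s ha hw hb p)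
      (integrable_eval_contour_mul c K s ha hw hb q)
  map_smul' z p := by
    simp only [MvPolynomial.smul_eval, mul_assoc, RingHom.id_apply, smul_eq_mul]
    exact integral_const_mul _ _

/-- The rate a/(2(|y|+1)) makes the growth in x at most e^{a|x|/2}, half of the decay of w. -/
theorem integrable_exp_mul_norm_eval_contour {d : ℕ} {c : ℂ} (hc : c ≠ 0) (K : ℝ)
    (s : Fin d → Bool) {w : LieAlg d → ℂ} {C a : ℝ} (ha : 0 < a)
    (hw : Continuous fun x => w (complexify d x))
    (hb : ∀ x, ‖w (complexify d x)‖ ≤ C * Real.exp (-a * ‖x‖)) (y : EuclideanSpace ℝ (Fin d)) :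
    Integrable fun x => Real.exp (a / (2 * (‖y‖ + 1)) *
      ‖MvPolynomial.eval (contour c K s x) (scaledForm c (complexify d y))‖) *
        ‖w (complexify d x)‖ := by
  set B := ‖(K : ℂ) * ∑ k, (if s k then (1 : ℂ) else -1) * complexify d y k‖ with hB
  set r := a / (2 * (‖y‖ + 1)) with hr
  have hr0 : 0 < r := by positivity
  refine ((integrable_exp_neg_mul_norm d (half_pos ha)).const_mul (Real.exp (r * B) * C)).mono' ?_
    (Filter.Eventually.of_forall fun x => ?_)
  · have : Continuous fun x =>
        MvPolynomial.eval (contour c K s x) (scaledForm c (complexify d y)) :=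
      (MvPolynomial.continuous_eval _).comp (continuous_contour c K s)
    exact ((Real.continuous_exp.comp (continuous_const.mul this.norm)).mul
      hw.norm).aestronglyMeasurable
  · rw [Real.norm_of_nonneg (by positivity), eval_contour_scaledForm hc]
    have h1 : ‖Complex.I * dotProd (complexify d x) (complexify d y) +
        K * ∑ k, (if s k then (1 : ℂ) else -1) * complexify d y k‖ ≤ ‖x‖ * ‖y‖ + B := by
      refine (norm_add_le _ _).trans (add_le_add ?_ le_rfl)
      rw [norm_mul, Complex.norm_I, one_mul, dotProd_complexify, Complex.norm_real]
      exact norm_inner_le_norm x y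
    have h2 : r * (‖x‖ * ‖y‖ + B) ≤ r * B + a / 2 * ‖x‖ := by
      have : r * ‖y‖ ≤ a / 2 := by
        rw [hr, div_mul_eq_mul_div, div_le_div_iff₀ (by positivity) (by norm_num)]
        nlinarith
      nlinarith [norm_nonneg x]
    calc _ ≤ Real.exp (r * B + a / 2 * ‖x‖) * (C * Real.exp (-a * ‖x‖)) := by
          refine mul_le_mul (Real.exp_le_exp.2 (le_trans ?_ h2)) (hb x) (norm_nonneg _)
            (by positivity)
          exact mul_le_mul_of_nonneg_left h1 hr0.le
      _ = Real.exp (r * B) * C * (Real.exp (a / 2 * ‖x‖) * Real.exp (-a * ‖x‖)) := by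
        rw [Real.exp_add]
        ring
      _ = _ := by
        rw [← Real.exp_add]
        ring_nf

theorem eventuallyEq_of_forall_ofReal {f g : ℂ → ℂ} (hf : AnalyticAt ℂ f 0)
    (hg : AnalyticAt ℂ g 0) (h : ∀ t : ℝ, f t = g t) : f =ᶠ[nhds 0] g := by
  refine (hf.frequently_eq_iff_eventually_eq hg).1 ?_
  have hu : Filter.Tendsto (fun n : ℕ => (((1 / ((n : ℝ) + 1) : ℝ)) : ℂ)) Filter.atTop
      (nhdsWithin 0 {0}ᶜ) := by
    rw [tendsto_nhdsWithin_iff]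
    refine ⟨(Complex.continuous_ofReal.tendsto 0).comp tendsto_one_div_add_atTop_nhds_zero_nat,
      Filter.Eventually.of_forall fun n => ?_⟩
    have : (1 / ((n : ℝ) + 1)) ≠ 0 := by positivity
    exact Complex.ofReal_ne_zero.2 this
  exact hu.frequently (Filter.Frequently.of_forall fun n => h _)

theorem complexify_realPart {d : ℕ} {y : LieAlg d} (hy : y ∈ realForm d) :
    complexify d (realPart y) = y := by
  ext k
  exact Complex.ext rfl (hy k).symm

/-- A functional with tame generating function is a finite sum of contour integrals. -/
theorem HasTameGenerating.exists_contourIntegral {d : ℕ} {c : ℂ} (hc : c ≠ 0)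
    {T : MvPolynomial (Fin d) ℂ →ₗ[ℂ] ℂ} (hT : HasTameGenerating c T) :
    ∃ (K δ C a : ℝ) (w : LieAlg d → ℂ), 0 < δ ∧ 0 < a ∧ DifferentiableOn ℂ w (strip d δ) ∧
      (∀ x ∈ strip d δ, ‖w x‖ ≤ C * Real.exp (-a * ‖x‖)) ∧
      ∀ R, T R = ∑ s : Fin d → Bool,
        ∫ x, MvPolynomial.eval (contour c K s x) R * w (complexify d x) := by
  obtain ⟨F, hF, hgen⟩ := hT
  obtain ⟨K, e, C₀, he, hC₀, hd, hb, hsum⟩ := hF.exists_decay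
  obtain ⟨w, δ, C, a, hδ, ha, hC, hwd, hwb, hw⟩ := exists_eq_integral_exp_mul he hC₀ hd hb
  refine ⟨K, δ, C, a, w, hδ, ha, hwd, hwb, ?_⟩
  have hcont : Continuous fun x => w (complexify d x) :=
    hwd.continuousOn.comp_continuous (by fun_prop) fun v => complexify_mem_strip v hδ
  have hbound : ∀ x, ‖w (complexify d x)‖ ≤ C * Real.exp (-a * ‖x‖) := fun x => by
    simpa using hwb _ (complexify_mem_strip x hδ)
  suffices T = ∑ s, contourIntegral c K s ha hcont hbound by
    intro R
    rw [this, LinearMap.sum_apply]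
    rfl
  -- It is enough to compare moments along real y. These are Taylor coefficients at t = 0 of F(ty)
  -- and of a sum of integrals of e^{tg}, which are analytic near 0 and agree for real t by Fourier
  -- inversion.
  refine eq_of_scaledForm_pow_eq hc fun y' n hy' => ?_
  obtain ⟨y, rfl⟩ : ∃ y, complexify d y = y' := ⟨_, complexify_realPart hy'⟩
  rw [← hgen, LinearMap.sum_apply]
  set g : (Fin d → Bool) → EuclideanSpace ℝ (Fin d) → ℂ := fun s x =>
    MvPolynomial.eval (contour c K s x) (scaledForm c (complexify d y)) with hg
  set r := a / (2 * (‖y‖ + 1)) with hr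
  have hr0 : 0 < r := by positivity
  have hint : ∀ s, Integrable fun x => Real.exp (r * ‖g s x‖) * ‖w (complexify d x)‖ := fun s =>
    integrable_exp_mul_norm_eval_contour hc K s ha hcont hbound y
  have hgm : ∀ s, AEStronglyMeasurable (g s) := fun s =>
    ((MvPolynomial.continuous_eval _).comp (continuous_contour c K s)).aestronglyMeasurable
  have hwm := hcont.aestronglyMeasurable (μ := volume)
  have h0 : (0 : ℂ) ∈ Metric.ball (0 : ℂ) (r / 2) := Metric.mem_ball_self (by positivity)
  have han : ∀ s, AnalyticAt ℂ
      (fun t : ℂ => ∫ x, Complex.exp (t * g s x) * w (complexify d x)) 0 := fun s =>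
    (differentiableOn_integral_exp hr0 (hgm s) hwm (hint s)).analyticAt
      (Metric.isOpen_ball.mem_nhds h0)
  have hreal : ∀ t : ℝ, F ((t : ℂ) • complexify d y) =
      ∑ s, ∫ x, Complex.exp (t * g s x) * w (complexify d x) := by
    intro t
    have hty : (t : ℂ) • complexify d y = complexify d (t • y) := by
      rw [map_smul]
      rfl
    rw [hty, hsum _ (complexify_mem_strip _ he)]
    refine Finset.sum_congr rfl fun s _ => ?_
    rw [hw, ← integral_const_mul]
    refine integral_congr_ae (Filter.Eventually.of_forall fun x => ?_)
    simp only [hg, eval_contour_scaledForm hc]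
    rw [← mul_assoc, ← Complex.exp_add]
    congr 2
    rw [← hty]
    simp only [dotProd, PiLp.smul_apply, smul_eq_mul, mul_add, Finset.mul_sum]
    rw [add_comm]
    congr 1 <;> refine Finset.sum_congr rfl fun k _ => by ring
  have hFan : AnalyticAt ℂ (fun t : ℂ => F (t • complexify d y)) 0 := by
    obtain ⟨e', C', A', he', -, -, hd', -⟩ := hF
    refine DifferentiableOn.analyticAt (s := {t : ℂ | t • complexify d y ∈ strip d e'})
      (hd'.comp (by fun_prop) fun t ht => ht) ?_
    refine ((isOpen_strip d e').preimage (by fun_prop)).mem_nhds ?_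
    simpa using zero_mem_strip d he'
  have hev := eventuallyEq_of_forall_ofReal hFan
    (Finset.analyticAt_fun_sum Finset.univ fun s _ => han s) hreal
  rw [hev.iteratedDeriv_eq, iteratedDeriv_fun_sum fun s _ => (han s).contDiffAt]
  refine Finset.sum_congr rfl fun s _ => ?_
  rw [iteratedDeriv_integral_exp hr0 (hgm s) hwm (hint s) n 0 h0]
  simp [contourIntegral, hg]

/-! ### The contour integrals as integrals over rotated real forms -/

/-- The isometric embedding `x ↦ c⁻¹ x` of `ℝ^d` in `𝔱`, for `|c| = 1`. -/
noncomputable def rotatedEmbedding (d : ℕ) {c : ℂ} (hc : ‖c‖ = 1) :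
    EuclideanSpace ℝ (Fin d) →ₗᵢ[ℝ] LieAlg d where
  toFun v := c⁻¹ • complexify d v
  map_add' v w := by rw [map_add, smul_add]
  map_smul' r v := by
    rw [map_smul, RingHom.id_apply, smul_comm]
  norm_map' v := by
    change ‖c⁻¹ • complexify d v‖ = ‖v‖
    rw [norm_smul, norm_inv, hc, inv_one, one_mul, LinearIsometry.norm_map]

theorem rotatedEmbedding_apply {d : ℕ} {c : ℂ} (hc : ‖c‖ = 1) (v : EuclideanSpace ℝ (Fin d)) :
    rotatedEmbedding d hc v = c⁻¹ • complexify d v := rfl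

/-- The real subspace `c⁻¹ ℝ^d` of `𝔱`. -/
noncomputable def rotatedRealForm (d : ℕ) {c : ℂ} (hc : ‖c‖ = 1) : Submodule ℝ (LieAlg d) :=
  LinearMap.range (rotatedEmbedding d hc).toLinearMap

theorem rotatedRealForm_le {d : ℕ} {c : ℂ} (hc : ‖c‖ = 1) (h1 : c = 1) :
    rotatedRealForm d hc ≤ realForm d := by
  rintro _ ⟨v, rfl⟩ k
  change (rotatedEmbedding d hc v k).im = 0
  simp [rotatedEmbedding_apply, h1]

theorem eq_zero_of_I_smul_mem_rotatedRealForm {d : ℕ} {c : ℂ} (hc : ‖c‖ = 1) {u : LieAlg d}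
    (hu : u ∈ rotatedRealForm d hc) (hIu : Complex.I • u ∈ rotatedRealForm d hc) : u = 0 := by
  have hc0 : c ≠ 0 := fun h => by simp [h] at hc
  obtain ⟨v, rfl⟩ := hu
  obtain ⟨v', hv'⟩ := hIu
  change c⁻¹ • complexify d v' = Complex.I • c⁻¹ • complexify d v at hv'
  rw [smul_comm, (smul_right_injective _ (inv_ne_zero hc0)).eq_iff] at hv'
  have hv : v = 0 := by
    ext k
    have := congrArg (fun z : LieAlg d => (z k).im) hv'
    simpa using this.symm
  rw [hv, map_zero]

theorem smul_mem_strip_of_mem_tube {d : ℕ} {c : ℂ} (hc : ‖c‖ = 1) {δ : ℝ} {z : LieAlg d}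
    (hz : z ∈ tube (rotatedRealForm d hc) δ) : c • z ∈ strip d δ := by
  have hc0 : c ≠ 0 := fun h => by simp [h] at hc
  obtain ⟨_, ⟨x, rfl⟩, _, ⟨y, rfl⟩, hy, rfl⟩ := hz
  change ‖rotatedEmbedding d hc y‖ < δ at hy
  rw [LinearIsometry.norm_map] at hy
  have h : c • (rotatedEmbedding d hc x + Complex.I • rotatedEmbedding d hc y) =
      complexify d x + Complex.I • complexify d y := by
    rw [rotatedEmbedding_apply, rotatedEmbedding_apply, smul_add, smul_comm c Complex.I,
      smul_inv_smul₀ hc0, smul_inv_smul₀ hc0]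
  change c • (rotatedEmbedding d hc x + Complex.I • rotatedEmbedding d hc y) ∈ _
  rw [h]
  intro k
  have h3 := PiLp.norm_apply_le y k
  rw [Real.norm_eq_abs] at h3
  have h4 : ((complexify d x + Complex.I • complexify d y) k).im = y k := by simp
  rw [h4]
  exact h3.trans_lt hy

theorem integral_lebesgue_rotatedRealForm {d : ℕ} {c : ℂ} (hc : ‖c‖ = 1) (f : LieAlg d → ℂ) :
    ∫ u : rotatedRealForm d hc, f u ∂(lebesgue (rotatedRealForm d hc)) =
      ∫ x, f (rotatedEmbedding d hc x) := by
  let e : EuclideanSpace ℝ (Fin d) ≃ₗᵢ[ℝ] rotatedRealForm d hc :=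
    (rotatedEmbedding d hc).equivRange
  rw [lebesgue, OrthonormalBasis.addHaar_eq_volume]
  exact (e.measurePreserving.integral_comp e.toHomeomorph.measurableEmbedding
    fun u : rotatedRealForm d hc => f u).symm

/-- The integral along a contour of weight `w`, as an integral over `U + iη`. -/
noncomputable def contourTerm {d : ℕ} {c : ℂ} (hc : ‖c‖ = 1) (K : ℝ) (s : Fin d → Bool)
    {w : LieAlg d → ℂ} {δ C a : ℝ} (hδ : 0 < δ) (ha : 0 < a)
    (hw : DifferentiableOn ℂ w (strip d δ))
    (hb : ∀ x ∈ strip d δ, ‖w x‖ ≤ C * Real.exp (-a * ‖x‖)) : IntegralTerm d where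
  U := rotatedRealForm d hc
  totallyReal _ hu hIu := eq_zero_of_I_smul_mem_rotatedRealForm hc hu hIu
  D := 1
  D_mem := one_mem _
  -- The polynomial is evaluated at i(u + iη) = iu - η, so the real shift c⁻¹Ks of the contour
  -- enters η with a minus sign.
  eta := WithLp.toLp 2 fun k => -(c⁻¹ * (K * (if s k then (1 : ℂ) else -1)))
  eps := δ
  eps_pos := hδ
  w z := w (c • z)
  holomorphic := hw.comp (by fun_prop) fun _ hz => smul_mem_strip_of_mem_tube hc hz
  decay := by
    refine ⟨C, a, ha, fun z hz => ?_⟩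
    have := hb _ (smul_mem_strip_of_mem_tube hc hz)
    rwa [norm_smul, hc, one_mul] at this

theorem contourTerm_value {d : ℕ} {c : ℂ} (hc : ‖c‖ = 1) (K : ℝ) (s : Fin d → Bool)
    {w : LieAlg d → ℂ} {δ C a : ℝ} (hδ : 0 < δ) (ha : 0 < a)
    (hw : DifferentiableOn ℂ w (strip d δ))
    (hb : ∀ x ∈ strip d δ, ‖w x‖ ≤ C * Real.exp (-a * ‖x‖)) (R : MvPolynomial (Fin d) ℂ) :
    (contourTerm hc K s hδ ha hw hb).value R =
      ∫ x, MvPolynomial.eval (contour c K s x) R * w (complexify d x) := by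
  have hc0 : c ≠ 0 := fun h => by simp [h] at hc
  set t := contourTerm hc K s hδ ha hw hb with ht
  refine (integral_lebesgue_rotatedRealForm hc fun u => MvPolynomial.eval
    (fun k => (Complex.I • (u + Complex.I • t.eta)) k) (t.D R) * t.w u).trans ?_
  refine integral_congr_ae (Filter.Eventually.of_forall fun x => ?_)
  have hx : (fun k => (Complex.I • (rotatedEmbedding d hc x + Complex.I • t.eta)) k) =
      contour c K s x := by
    funext k
    simp only [ht, contourTerm, rotatedEmbedding_apply, contour, PiLp.smul_apply, PiLp.add_apply,
      smul_eq_mul, complexify_apply]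
    linear_combination (-(c⁻¹ * (K * (if s k then (1 : ℂ) else -1)))) * Complex.I_mul_I
  have hwx : t.w (rotatedEmbedding d hc x) = w (complexify d x) := by
    simp only [ht, contourTerm, rotatedEmbedding_apply, smul_inv_smul₀ hc0]
  simp only [hx, hwx]
  rfl

/-- A functional with tame generating function is a finite sum of integrals. -/
theorem HasTameGenerating.exists_integralTerm {d : ℕ} {c : ℂ} (hc : ‖c‖ = 1)
    {T : MvPolynomial (Fin d) ℂ →ₗ[ℂ] ℂ} (hT : HasTameGenerating c T) :
    ∃ (N : ℕ) (t : Fin N → IntegralTerm d), (∀ R, T R = ∑ k, (t k).value R) ∧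
      ∀ k, (t k).U = rotatedRealForm d hc := by
  have hc0 : c ≠ 0 := fun h => by simp [h] at hc
  obtain ⟨K, δ, C, a, w, hδ, ha, hw, hb, h⟩ := hT.exists_contourIntegral hc0
  let e := Fintype.equivFin (Fin d → Bool)
  refine ⟨_, fun k => contourTerm hc K (e.symm k) hδ ha hw hb, fun R => ?_, fun _ => rfl⟩
  simp only [contourTerm_value]
  rw [h, e.symm.sum_comp fun s => ∫ x, MvPolynomial.eval (contour c K s x) R * w (complexify d x)]

/-! ### Assembling the proof -/

/-- The list holds the directions still to be treated. Composing with the difference operator of its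
head makes T transverse to that direction and keeps earlier transversality, since the operators
commute and preserve it. With an empty list every flat has a transverse direction and the
finite-dimensional case applies; on the way back one divides once per element. -/
theorem hasTameGenerating_of_list {d n : ℕ} {xi : Fin n → Fin d → ℤ} {zeta : Fin d → ℂ} {c : ℂ}
    (hc : 0 < c.re) (L : List (Fin d → ℤ))
    (hL : ∀ l ∈ L, l ≠ 0 ∧ ∀ x : ℝ, Complex.exp (c * x) = twistFactor zeta l → x = 0)
    (T : MvPolynomial (Fin d) ℂ →ₗ[ℂ] ℂ)
    (hT : ∀ l, IsTransverse xi (T ∘ₗ quasiDifference (twistFactor zeta l) l) l)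
    (hS : ∀ (S : Set (Fin n)) (l₀ : Fin d → ℤ), l₀ ≠ 0 → (∀ i ∈ S, pairing (xi i) l₀ = 0) →
      ∃ l, (∀ i ∈ S, pairing (xi i) l = 0) ∧ (l ∈ L ∨ IsTransverse xi T l)) :
    HasTameGenerating c T := by
  induction L generalizing T with
  | nil =>
    refine hasTameGenerating_of_finite c (finite_quotient_kernelIdeal (xi := xi) ?_)
    simpa using hS
  | cons m L ih =>
    obtain ⟨hm, hreal⟩ := hL m List.mem_cons_self
    refine HasTameGenerating.of_comp_quasiDifference hc (Complex.exp_ne_zero _) hm hreal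
      (ih (fun l hl => hL l (List.mem_cons_of_mem _ hl)) _ (fun l => ?_) fun S l₀ hl₀ hSl₀ => ?_)
    · rw [LinearMap.comp_assoc, quasiDifference_comm, ← LinearMap.comp_assoc]
      exact (hT l).comp_quasiDifference _ _
    · obtain ⟨l, hl, h⟩ := hS S l₀ hl₀ hSl₀
      refine ⟨l, hl, ?_⟩
      rcases h with h | h
      · rcases List.mem_cons.1 h with rfl | h
        · exact Or.inr (hT _)
        · exact Or.inl h
      · exact Or.inr (h.comp_quasiDifference _ _)

/-- The restriction of a twisted trace to `ℂ[𝔱]` has a tame generating function. -/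
theorem IsTwistedTrace.hasTameGenerating {d n : ℕ} {xi : Fin n → Fin d → ℤ} {b : Fin n → ℂ}
    {zeta : Fin d → ℂ} {T : Branch d →ₗ[ℂ] ℂ} (hT : IsTwistedTrace xi b zeta T) {c : ℂ}
    (hc : 0 < c.re) (hreal : ∀ l, SpansFlat xi l →
      ∀ x : ℝ, Complex.exp (c * x) = twistFactor zeta l → x = 0) :
    HasTameGenerating c (restrictCartan T) := by
  classical
  by_cases hspan : ∀ l : Fin d → ℤ, (∀ i, pairing (xi i) l = 0) → l = 0
  -- One spanning vector of a one-dimensional flat is chosen for each set of weights with a nonzero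
  -- common zero; being finitely many, they form the list. The default 0 is filtered out later.
  · have hex : ∀ S : Finset (Fin n), ∃ l, (∃ m, SpansFlat xi m ∧ ∀ i ∈ S, pairing (xi i) m = 0) →
        SpansFlat xi l ∧ ∀ i ∈ S, pairing (xi i) l = 0 := fun S => by
      by_cases h : ∃ m, SpansFlat xi m ∧ ∀ i ∈ S, pairing (xi i) m = 0
      · exact h.imp fun m hm _ => hm
      · exact ⟨0, fun h' => absurd h' h⟩
    choose f hf using hex
    refine hasTameGenerating_of_list (xi := xi) (zeta := zeta) hc
      ((Finset.univ.filter fun S => SpansFlat xi (f S)).toList.map f) (fun l hl => ?_) _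
      hT.isTransverse fun S l₀ hl₀ hSl₀ => ?_
    · simp only [List.mem_map, Finset.mem_toList, Finset.mem_filter, Finset.mem_univ,
        true_and] at hl
      obtain ⟨S, hS, rfl⟩ := hl
      exact ⟨hS.1, hreal _ hS⟩
    · obtain ⟨h1, h2⟩ := hf S.toFinset
        (exists_spansFlat hspan hl₀ fun i hi => hSl₀ i (Set.mem_toFinset.1 hi))
      refine ⟨f S.toFinset, fun i hi => h2 i (Set.mem_toFinset.2 hi), Or.inl ?_⟩
      simp only [List.mem_map, Finset.mem_toList, Finset.mem_filter, Finset.mem_univ, true_and]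
      exact ⟨S.toFinset, h1, rfl⟩
  -- All weights vanish on some λ ≠ 0, so the annihilating product is 1 and T ∘ (1 - q S_{-λ}) = 0;
  -- then F = 0 generates T.
  · push Not at hspan
    obtain ⟨l, hl, hl0⟩ := hspan
    have hc0 : c ≠ 0 := by
      rintro rfl
      simp at hc
    obtain ⟨R, hR, hTR⟩ := hT.isTransverse l
    have hR1 : R = 1 := by
      have h : {p | ∃ i a, pairing (xi i) l ≠ 0 ∧
          p = linearForm (xi i) + MvPolynomial.C a} = ∅ := by
        ext p
        simp [hl]
      rwa [transverseForms, h, Submonoid.closure_empty, Submonoid.mem_bot] at hR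
    refine ⟨fun _ => 0, ⟨1, 0, 0, one_pos, le_rfl, le_rfl, differentiableOn_const _, by simp⟩,
      IsGenerating.of_mul (q := twistFactor zeta l) hc0 hl0 one_pos (F := fun _ => 0)
        (differentiableOn_const _) (by simp) fun y k => ?_⟩
    have := hTR (scaledForm c y ^ k)
    rw [hR1, one_mul] at this
    rw [this]
    simp

/-- All but countably many directions avoid the logarithms of a countable set of numbers. -/
theorem exists_direction {Q : Set ℂ} (hQ : Q.Countable) (h0 : (0 : ℂ) ∉ Q) :
    ∃ c : ℂ, ‖c‖ = 1 ∧ 0 < c.re ∧ ∀ q ∈ Q, ∀ x : ℝ, Complex.exp (c * x) = q → x = 0 := by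
  -- If e^{cx} = q with x real and nonzero, the slope Im c / Re c equals (Im log q + 2πm)/Re log q
  -- for some integer m. Any κ outside this countable set of slopes works; Re log q ≠ 0 in that case
  -- because Re c ≠ 0.
  have hcount : (⋃ q ∈ Q, Set.range fun m : ℤ =>
      ((Complex.log q).im + m * (2 * Real.pi)) / (Complex.log q).re).Countable :=
    hQ.biUnion fun q _ => Set.countable_range _
  obtain ⟨κ, hκ⟩ := (hcount.dense_compl ℝ).nonempty
  set z : ℂ := 1 + κ * Complex.I with hz
  have hzre : z.re = 1 := by simp [hz]
  have hzim : z.im = κ := by simp [hz]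
  have hz0 : 0 < ‖z‖ := by
    rw [norm_pos_iff]
    intro h
    simp [h] at hzre
  refine ⟨z / ‖z‖, ?_, ?_, fun q hq x hx => ?_⟩
  · rw [norm_div, Complex.norm_real, norm_norm, div_self hz0.ne']
  · rw [Complex.div_ofReal_re, hzre]
    positivity
  · by_contra hx0
    refine hκ (Set.mem_biUnion hq ?_)
    have hq0 : q ≠ 0 := fun h => h0 (h ▸ hq)
    rw [← Complex.exp_log hq0, Complex.exp_eq_exp_iff_exists_int] at hx
    obtain ⟨m, hm⟩ := hx
    have hm' : ((x / ‖z‖ : ℝ) : ℂ) * z = Complex.log q + m * (2 * Real.pi * Complex.I) := by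
      rw [← hm]
      push_cast
      ring
    have hre := congrArg Complex.re hm'
    have him := congrArg Complex.im hm'
    rw [Complex.re_ofReal_mul, hzre] at hre
    rw [Complex.im_ofReal_mul, hzim] at him
    simp at hre him
    have hy : x / ‖z‖ ≠ 0 := div_ne_zero hx0 hz0.ne'
    refine ⟨m, ?_⟩
    simp only
    rw [← hre, div_eq_iff hy]
    linarith

end AbelianCoulomb


theorem corollary3p7 (d n : ℕ) (xi : Fin n → Fin d → ℤ) (b : Fin n → ℂ) (zeta : Fin d → ℂ)
    (T : AbelianCoulomb.Branch d →ₗ[ℂ] ℂ) (hT : AbelianCoulomb.IsTwistedTrace xi b zeta T) :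
    (∃ (N : ℕ) (t : Fin N → AbelianCoulomb.IntegralTerm d),
      AbelianCoulomb.IsSumOfIntegrals T t) ∧
    ((∀ l : Fin d → ℤ, AbelianCoulomb.SpansFlat xi l →
        ∀ s : ℝ, 0 < s → AbelianCoulomb.twistFactor zeta l = (s : ℂ) → s = 1) →
      ∃ (N : ℕ) (t : Fin N → AbelianCoulomb.IntegralTerm d),
        AbelianCoulomb.IsSumOfIntegrals T t ∧
          ∀ k, (t k).U ≤ AbelianCoulomb.realForm d) := by
  constructor
  -- Y is countable, so one direction c avoids the logarithms of all twist factors at once.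
  · obtain ⟨c, hc, hre, h⟩ := AbelianCoulomb.exists_direction
      (Set.countable_range (AbelianCoulomb.twistFactor zeta))
      (by rintro ⟨l, hl⟩; exact Complex.exp_ne_zero _ hl)
    obtain ⟨N, t, ht, -⟩ :=
      (hT.hasTameGenerating hre fun l _ x hx => h _ ⟨l, rfl⟩ x hx).exists_integralTerm hc
    exact ⟨N, t, ht⟩
  · intro hpos
    -- With c = 1 a real solution of e^x = q forces q to be positive, hence equal to 1 by
    -- hypothesis, and x = 0.
    have hreal : ∀ l, AbelianCoulomb.SpansFlat xi l →
        ∀ x : ℝ, Complex.exp (1 * x) = AbelianCoulomb.twistFactor zeta l → x = 0 := by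
      intro l hl x hx
      have := hpos l hl (Real.exp x) (Real.exp_pos x) (by rw [← hx, one_mul, Complex.ofReal_exp])
      exact (Real.exp_eq_one_iff x).1 this
    obtain ⟨N, t, ht, hU⟩ :=
      (hT.hasTameGenerating (c := 1) (by simp) hreal).exists_integralTerm norm_one
    exact ⟨N, t, ht, fun k => (hU k).le.trans (AbelianCoulomb.rotatedRealForm_le _ rfl)⟩
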